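/- Let $(\xi_k)_{k\in\mathbb Z}$ be identically distributed (integrable) martingale differences adapted to a filtration $(\mathcal F_k)_{k\in\mathbb Z}$ on a probability space, with $\mathbb E\xi_0^2=\infty$ and such that $H_0(x)=\mathbb E(\xi_0^2 I(|\xi_0|\le x))$ is slowly varying at $\infty$. Put $b=\inf\{x\ge 0: H_0(x)>1\}$ and $H(x)=H_0(\max(x,b+1))$, so that $H\ge 1$ and $H=H_0$ on $[b+1,\infty)$. Let $(c_{nk})_{1\le k\le m_n}$ be a triangular array of real numbers and let $$D_n=\inf\Big\{s\ge 1:\ \sum_{k=1}^{m_n}\frac{c_{nk}^2}{s^2}\,H\Big(\frac{s}{|c_{nk}|}\Big)\le 1\Big\},$$ where here and below terms with $c_{nk}=0$ are read as $0$. Assume $$\max_{1\le k\le m_n}\frac{c_{nk}^2}{D_n^2}\,H\Big(\frac{D_n}{|c_{nk}|}\Big)\to 0\quad\text{as } n\to\infty. \qquad (1)$$ (i) If $$\frac1{D_n^2}\sum_{k=1}^{m_n}c_{nk}^2\xi_k^2\to 1\quad\text{in probability}, \qquad (2)$$ then $\displaystyle \frac1{D_n}\sum_{k=1}^{m_n}c_{nk}\xi_k\Rightarrow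 N(0,1)$ in distribution. (ii) Suppose moreover that the array is not degenerate, in the sense that $\liminf_{n}\sum_{k=1}^{m_n}c_{nk}^2H(1/|c_{nk}|)\ge 1$. Then (2) holds under either of the following conditions. $(M_1)$ There are positive numbers $\psi_k\to 0$ such that for all $a,b>0$, all integers $j$ and all $k\ge 1$, $$\operatorname{cov}\big(\xi_j^2I(|\xi_j|\le a),\ \xi_{j+k}^2I(|\xi_{j+k}|\le b)\big)\le \psi_k\,\mathbb E(\xi_0^2I(|\xi_0|\le b))\,\mathbb E(\xi_0^2I(|\xi_0|\le a)).$$ $(M_2)$ There are positive numbers $\varphi_k$ with $\sum_{k\ge1}\varphi_k<\infty$ such that for all $a,b>0$, all integers $j$ and all $k\ge 1$, $$\operatorname{cov}\big(\xi_j^2I(|\xi_j|\le a),\ \xi_{j+k}^2I(|\xi_{j+k}|\le b)\big)\le a^2\varphi_k\,\mathbb E(\xi_0^2I(|\xi_0|\le b)).$$ -/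

import Mathlib

open MeasureTheory ProbabilityTheory Filter Topology

noncomputable section

/-- Integrable martingale differences, indexed by `ℤ`, adapted to the filtration `ℱ`. -/
structure IsMartingaleDifference {Ω : Type*} {mΩ : MeasurableSpace Ω}
    (ℱ : Filtration ℤ mΩ) (μ : Measure Ω) (ξ : ℤ → Ω → ℝ) : Prop where
  stronglyAdapted : StronglyAdapted ℱ ξ
  integrable : ∀ k, Integrable (ξ k) μ
  condExp_eq_zero : ∀ k, μ[ξ k | ℱ (k - 1)] =ᵐ[μ] 0

/-- Slow variation at `∞` in the sense of Karamata. -/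
def IsSlowlyVarying (L : ℝ → ℝ) : Prop :=
  (∀ᶠ x in atTop, 0 < L x) ∧ ∀ t : ℝ, 0 < t → Tendsto (fun x => L (t * x) / L x) atTop (𝓝 1)

/-- The truncated square `X² I(|X| ≤ x)`. -/
def truncSq {Ω : Type*} (X : Ω → ℝ) (x : ℝ) : Ω → ℝ :=
  Set.indicator {ω | |X ω| ≤ x} (fun ω => X ω ^ 2)

/-- The truncated second moment `E (X² I(|X| ≤ x))`. -/
def truncMoment {Ω : Type*} [MeasurableSpace Ω] (μ : Measure Ω) (X : Ω → ℝ) (x : ℝ) : ℝ :=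
  ∫ ω, truncSq X x ω ∂μ

/-- The level `b = inf {x ≥ 0 : E (X² I(|X| ≤ x)) > 1}`. -/
def truncLevel {Ω : Type*} [MeasurableSpace Ω] (μ : Measure Ω) (X : Ω → ℝ) : ℝ :=
  sInf {x : ℝ | 0 ≤ x ∧ 1 < truncMoment μ X x}

/-- The function `H`: the truncated second moment, modified below `b + 1` so that it is
at least `1` everywhere (when `E X² = ∞`). -/
def truncH {Ω : Type*} [MeasurableSpace Ω] (μ : Measure Ω) (X : Ω → ℝ) (x : ℝ) : ℝ :=
  truncMoment μ X (max x (truncLevel μ X + 1))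

/-- The `k`-th term `(c_{nk}² / s²) H(s / |c_{nk}|)`; it is `0` when `c_{nk} = 0`. -/
def normTerm (H : ℝ → ℝ) (c : ℕ → ℕ → ℝ) (n : ℕ) (s : ℝ) (k : ℕ) : ℝ :=
  c n k ^ 2 / s ^ 2 * H (s / |c n k|)

/-- The normalizer `D_n = inf {s ≥ 1 : ∑_{k=1}^{m_n} (c_{nk}² / s²) H(s / |c_{nk}|) ≤ 1}`. -/
def normalizer (H : ℝ → ℝ) (m : ℕ → ℕ) (c : ℕ → ℕ → ℝ) (n : ℕ) : ℝ :=
  sInf {s : ℝ | 1 ≤ s ∧ ∑ k ∈ Finset.Icc 1 (m n), normTerm H c n s k ≤ 1}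

/-- The pairwise mixing condition (M₁). -/
def MixingM1 {Ω : Type*} [MeasurableSpace Ω] (μ : Measure Ω) (ξ : ℤ → Ω → ℝ) : Prop :=
  ∃ ψ : ℕ → ℝ, (∀ k, 0 < ψ k) ∧ Tendsto ψ atTop (𝓝 0) ∧
    ∀ (j : ℤ) (k : ℕ), 1 ≤ k → ∀ a b : ℝ, 0 < a → 0 < b →
      cov[truncSq (ξ j) a, truncSq (ξ (j + k)) b; μ] ≤
        ψ k * truncMoment μ (ξ 0) b * truncMoment μ (ξ 0) a

/-- The pairwise mixing condition (M₂). -/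
def MixingM2 {Ω : Type*} [MeasurableSpace Ω] (μ : Measure Ω) (ξ : ℤ → Ω → ℝ) : Prop :=
  ∃ φ : ℕ → ℝ, (∀ k, 0 < φ k) ∧ Summable φ ∧
    ∀ (j : ℤ) (k : ℕ), 1 ≤ k → ∀ a b : ℝ, 0 < a → 0 < b →
      cov[truncSq (ξ j) a, truncSq (ξ (j + k)) b; μ] ≤
        a ^ 2 * φ k * truncMoment μ (ξ 0) b

end

/-! Write `r n k = |c n k| / D n` and `x_k = c n k * ξ k / D n`.

Part (i) is McLeish's method. The factor `e^{itx}` agrees with `(1 + itx) e^{-t²x²/2}` up to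
`O(|tx|³)`, so `e^{itS}` is close to `∏ (1 + i t x_k) · e^{-t²/2}` once `∑ x_k²` is close to one and
all terms are small. The product has mean one by the martingale property. Stopping it when the sum
of squares passes 2 bounds it by `e^{t²} (1 + |t| max |x_k|)`. No uniform integrability is needed: a
pointwise inequality (`norm_exp_sum_sub_stoppedProd_le`) bounds the error by `δ`, the indicator that
`∑ x_k²` misses 1 by `δ`, and `∑ |x_k| I(|x_k| > δ)`. Integration leaves two inputs: hypothesis (2),
and the vanishing of `∑ E |x_k| I(|x_k| > δ)`.

The second input comes from slow variation. A Karamata estimate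
(`eventually_mul_integral_absTail_le`) gives `x E(|ξ| I(|ξ| > x)) = o(H(x))`. Since `H ≥ 1`,
assumption (1) forces `r n k → 0` uniformly in `k`, so the estimate applies at `x = δ / r n k`, and
the tail sum is `o(∑ r² H(1/r)) = o(1)` because the normalizer keeps that sum at most one.

Part (ii) truncates `ξ k` at `ε / r n k`. The truncation changes nothing outside an event of
vanishing probability, by the same tail estimate. The mean of the truncated sum tends to one by slow
variation and nondegeneracy. Its variance is `O(ε) + o(1)` by the mixing condition, and Chebyshev's
inequality concludes. -/

/-! ### Deterministic estimates for McLeish's product. -/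

open Complex in
theorem norm_exp_mul_I_sub_le {x : ℝ} (hx : |x| ≤ 1) :
    ‖cexp (x * I) - (1 + x * I) * cexp (-(x ^ 2 / 2 : ℝ))‖ ≤ 2 * |x| ^ 3 := by
  have hn : ‖(x * I : ℂ)‖ = |x| := by simp
  have h1 := Complex.exp_bound (x := x * I) (by rw [hn]; exact hx) (n := 3) (by norm_num)
  rw [hn] at h1
  have hy : ‖((-(x ^ 2 / 2) : ℝ) : ℂ)‖ = |x| ^ 2 / 2 := by
    rw [Complex.norm_real, norm_neg, Real.norm_eq_abs, abs_of_nonneg (by positivity), sq_abs]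
  have hx0 := abs_nonneg x
  have h2 := Complex.norm_exp_sub_one_sub_id_le (x := ((-(x ^ 2 / 2) : ℝ) : ℂ))
    (by rw [hy]; nlinarith)
  rw [hy] at h2
  have h3 : ‖(1 + x * I : ℂ)‖ ≤ 2 := by
    refine (norm_add_le _ _).trans ?_
    rw [hn, norm_one]; linarith
  -- Both expansions agree through order two; the last summand is the cross term of `x * I` with
  -- `-x² / 2`.
  have key : cexp (x * I) - (1 + x * I) * cexp (-(x ^ 2 / 2 : ℝ)) =
      (cexp (x * I) - ∑ m ∈ Finset.range 3, (x * I : ℂ) ^ m / m.factorial)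
      - (1 + x * I) * (cexp ((-(x ^ 2 / 2) : ℝ) : ℂ) - 1 - ((-(x ^ 2 / 2) : ℝ) : ℂ))
      + ((x ^ 3 / 2 : ℝ) : ℂ) * I := by
    have hI : (I : ℂ) ^ 2 = -1 := I_sq
    simp only [Finset.sum_range_succ, Finset.sum_range_zero, Nat.factorial]
    push_cast
    linear_combination ((x : ℂ) ^ 2 / 2) * hI
  rw [key]
  have h4 : ‖((x ^ 3 / 2 : ℝ) : ℂ) * I‖ = |x| ^ 3 / 2 := by
    rw [norm_mul, Complex.norm_I, mul_one, Complex.norm_real, Real.norm_eq_abs, abs_div, abs_pow]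
    norm_num
  have h5 : ‖(1 + x * I : ℂ) * (cexp ((-(x ^ 2 / 2) : ℝ) : ℂ) - 1 - ((-(x ^ 2 / 2) : ℝ) : ℂ))‖
      ≤ 2 * (|x| ^ 2 / 2) ^ 2 := by
    rw [norm_mul]; gcongr
  have h6 : |x| ^ 4 ≤ |x| ^ 3 := pow_le_pow_of_le_one hx0 hx (by norm_num)
  have h7 : 0 ≤ |x| ^ 3 := by positivity
  refine (norm_add_le _ _).trans ?_
  rw [h4]
  have h8 := norm_sub_le (cexp (x * I) - ∑ m ∈ Finset.range 3, (x * I : ℂ) ^ m / m.factorial)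
    ((1 + x * I : ℂ) * (cexp ((-(x ^ 2 / 2) : ℝ) : ℂ) - 1 - ((-(x ^ 2 / 2) : ℝ) : ℂ)))
  norm_num [Nat.factorial] at h1
  nlinarith

theorem norm_prod_sub_prod_le_sum (a b : ℕ → ℂ) (m : ℕ) (ha : ∀ k < m, ‖a k‖ ≤ 1)
    (hb : ∀ k < m, ‖b k‖ ≤ 1) :
    ‖∏ k ∈ Finset.range m, a k - ∏ k ∈ Finset.range m, b k‖ ≤
      ∑ k ∈ Finset.range m, ‖a k - b k‖ := by
  induction m with
  | zero => simp
  | succ m ih =>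
    have ih := ih (fun k hk => ha k (by omega)) (fun k hk => hb k (by omega))
    rw [Finset.prod_range_succ, Finset.prod_range_succ, Finset.sum_range_succ]
    have hP : ‖∏ k ∈ Finset.range m, b k‖ ≤ 1 := by
      rw [norm_prod]
      exact Finset.prod_le_one (fun _ _ => norm_nonneg _)
        fun k hk => hb k (by have := Finset.mem_range.1 hk; omega)
    calc ‖(∏ k ∈ Finset.range m, a k) * a m - (∏ k ∈ Finset.range m, b k) * b m‖
        = ‖(∏ k ∈ Finset.range m, a k - ∏ k ∈ Finset.range m, b k) * a m
            + (∏ k ∈ Finset.range m, b k) * (a m - b m)‖ := by ring_nf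
      _ ≤ ‖∏ k ∈ Finset.range m, a k - ∏ k ∈ Finset.range m, b k‖ * ‖a m‖
            + ‖∏ k ∈ Finset.range m, b k‖ * ‖a m - b m‖ := by
          refine (norm_add_le _ _).trans ?_
          rw [norm_mul, norm_mul]
      _ ≤ _ := by
          have := ha m (by omega)
          nlinarith [norm_nonneg (∏ k ∈ Finset.range m, a k - ∏ k ∈ Finset.range m, b k),
            norm_nonneg (a m - b m)]

theorem norm_one_add_mul_I_le (x : ℝ) : ‖(1 + x * Complex.I : ℂ)‖ ≤ Real.exp (x ^ 2 / 2) := by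
  rw [← abs_of_nonneg (Real.exp_pos (x ^ 2 / 2)).le, ← abs_of_nonneg (norm_nonneg _), ← sq_le_sq,
    ← Complex.normSq_eq_norm_sq, ← Real.exp_nat_mul]
  have : Complex.normSq (1 + x * Complex.I) = 1 + x ^ 2 := by
    simp [Complex.normSq_apply]; ring
  rw [this]
  have := Real.add_one_le_exp (x ^ 2)
  have h2 : ((2 : ℕ) : ℝ) * (x ^ 2 / 2) = x ^ 2 := by push_cast; ring
  rw [h2]; linarith

/-- The sequence `x`, stopped once the sum of the squares of the earlier terms exceeds `2`. -/
noncomputable def stoppedTerm (x : ℕ → ℝ) (k : ℕ) : ℝ :=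
  if ∑ i ∈ Finset.range k, x i ^ 2 ≤ 2 then x k else 0

/-- McLeish's product `∏ (1 + i t x_k)` over the stopped sequence. -/
noncomputable def stoppedProd (t : ℝ) (x : ℕ → ℝ) (m : ℕ) : ℂ :=
  ∏ k ∈ Finset.range m, (1 + (t * stoppedTerm x k : ℝ) * Complex.I)

theorem norm_stoppedProd_le_exp (t : ℝ) (x : ℕ → ℝ) (m : ℕ)
    (h : ∑ i ∈ Finset.range m, x i ^ 2 ≤ 2) : ‖stoppedProd t x m‖ ≤ Real.exp (t ^ 2) := by
  rw [stoppedProd, norm_prod]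
  calc ∏ k ∈ Finset.range m, ‖(1 + (t * stoppedTerm x k : ℝ) * Complex.I : ℂ)‖
      ≤ ∏ k ∈ Finset.range m, Real.exp (t ^ 2 / 2 * x k ^ 2) := by
        refine Finset.prod_le_prod (fun _ _ => norm_nonneg _) fun k _ => ?_
        refine (norm_one_add_mul_I_le _).trans (Real.exp_le_exp.2 ?_)
        have : stoppedTerm x k ^ 2 ≤ x k ^ 2 := by
          unfold stoppedTerm; split_ifs
          · exact le_rfl
          · simpa using sq_nonneg (x k)
        nlinarith [sq_nonneg t]
    _ = Real.exp (t ^ 2 / 2 * ∑ i ∈ Finset.range m, x i ^ 2) := by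
        rw [← Real.exp_sum, Finset.mul_sum]
    _ ≤ _ := Real.exp_le_exp.2 (by nlinarith [sq_nonneg t])

/-- Only the last factor before stopping can push the sum of squares past 2. The earlier factors
contribute at most `e^{t²}`, that one at most `1 + |t| M`, and all later ones equal 1. -/
theorem norm_stoppedProd_le (t : ℝ) (x : ℕ → ℝ) (m : ℕ) {M : ℝ} (hM0 : 0 ≤ M)
    (hM : ∀ k < m, |x k| ≤ M) : ‖stoppedProd t x m‖ ≤ Real.exp (t ^ 2) * (1 + |t| * M) := by
  have h1 : 1 ≤ 1 + |t| * M := by nlinarith [abs_nonneg t, mul_nonneg (abs_nonneg t) hM0]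
  have he := Real.exp_pos (t ^ 2)
  induction m with
  | zero =>
    have := Real.one_le_exp (sq_nonneg t)
    simp only [stoppedProd, Finset.range_zero, Finset.prod_empty, norm_one]
    nlinarith
  | succ m ih =>
    have ih := ih fun k hk => hM k (by omega)
    have hs : stoppedProd t x (m + 1) =
      stoppedProd t x m * (1 + (t * stoppedTerm x m : ℝ) * Complex.I) := Finset.prod_range_succ _ _
    rw [hs, norm_mul]
    by_cases h : ∑ i ∈ Finset.range m, x i ^ 2 ≤ 2
    · have h2 : ‖(1 + (t * stoppedTerm x m : ℝ) * Complex.I : ℂ)‖ ≤ 1 + |t| * M := by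
        refine (norm_add_le _ _).trans ?_
        rw [norm_one, norm_mul, Complex.norm_I, mul_one, Complex.norm_real, Real.norm_eq_abs,
          abs_mul, stoppedTerm, if_pos h]
        gcongr
        exact hM m (by omega)
      exact mul_le_mul (norm_stoppedProd_le_exp t x m h) h2 (norm_nonneg _) he.le
    · simpa [stoppedTerm, h] using ih

theorem stoppedProd_eq_of_sum_le (t : ℝ) (x : ℕ → ℝ) (m : ℕ)
    (h : ∑ i ∈ Finset.range m, x i ^ 2 ≤ 2) :
    stoppedProd t x m = ∏ k ∈ Finset.range m, (1 + (t * x k : ℝ) * Complex.I) := by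
  refine Finset.prod_congr rfl fun k hk => ?_
  rw [stoppedTerm, if_pos]
  refine (Finset.sum_le_sum_of_subset_of_nonneg ?_ fun _ _ _ => sq_nonneg _).trans h
  exact Finset.range_mono (Finset.mem_range.1 hk).le

theorem abs_exp_neg_sub_exp_neg_le {a b : ℝ} (ha : 0 ≤ a) (hb : 0 ≤ b) :
    |Real.exp (-a) - Real.exp (-b)| ≤ |a - b| := by
  wlog hab : a ≤ b generalizing a b
  · rw [abs_sub_comm, abs_sub_comm a b]; exact this hb ha (le_of_not_ge hab)
  have h1 : Real.exp (-b) ≤ Real.exp (-a) := Real.exp_le_exp.2 (by linarith)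
  rw [abs_of_nonneg (by linarith), abs_sub_comm, abs_of_nonneg (by linarith)]
  have h2 : Real.exp (-b) = Real.exp (-a) * Real.exp (a - b) := by
    rw [← Real.exp_add]; ring_nf
  have h3 := Real.add_one_le_exp (a - b)
  have h4 : Real.exp (-a) ≤ 1 := Real.exp_le_one_iff.2 (by linarith)
  have h5 := Real.exp_pos (-a)
  rw [h2]
  nlinarith

/-- Comparison of `e^{itS}` with McLeish's product when the squares sum to nearly one and all the
terms are small. -/
theorem norm_exp_sum_sub_stoppedProd_le_of_small (t : ℝ) (x : ℕ → ℝ) (m : ℕ) {δ : ℝ} (hδ : δ ≤ 1)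
    (htδ : |t| * δ ≤ 1) (hQ : |∑ i ∈ Finset.range m, x i ^ 2 - 1| ≤ δ)
    (hx : ∀ k < m, |x k| ≤ δ) :
    ‖Complex.exp ((t * ∑ k ∈ Finset.range m, x k : ℝ) * Complex.I)
      - stoppedProd t x m * Real.exp (-(t ^ 2 / 2))‖ ≤
      (4 * |t| ^ 3 + Real.exp (t ^ 2) * t ^ 2) * δ := by
  set Q := ∑ i ∈ Finset.range m, x i ^ 2 with hQdef
  have hδ0 : 0 ≤ δ := (abs_nonneg _).trans hQ
  have hQ2 : Q ≤ 2 := by have := (abs_le.1 hQ).2; linarith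
  have hQ0 : 0 ≤ Q := Finset.sum_nonneg fun _ _ => sq_nonneg _
  have e1 : Complex.exp ((t * ∑ k ∈ Finset.range m, x k : ℝ) * Complex.I) =
      ∏ k ∈ Finset.range m, Complex.exp ((t * x k : ℝ) * Complex.I) := by
    rw [← Complex.exp_sum, ← Finset.sum_mul, Finset.mul_sum]; push_cast; rfl
  have e2 : stoppedProd t x m * Real.exp (-(t ^ 2 / 2 * Q)) = ∏ k ∈ Finset.range m,
      ((1 + (t * x k : ℝ) * Complex.I) * Complex.exp (-((t * x k) ^ 2 / 2 : ℝ))) := by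
    rw [stoppedProd_eq_of_sum_le t x m hQ2, Finset.prod_mul_distrib, ← Complex.exp_sum,
      Complex.ofReal_exp]
    congr 2
    rw [hQdef]
    push_cast
    rw [Finset.mul_sum, ← Finset.sum_neg_distrib]
    exact Finset.sum_congr rfl fun _ _ => by ring
  have htx : ∀ k < m, |t * x k| ≤ 1 := fun k hk => by
    rw [abs_mul]; exact (mul_le_mul_of_nonneg_left (hx k hk) (abs_nonneg _)).trans htδ
  -- Each factor errs by at most `2 |t|³ δ x_k²`; the constant 4 then comes from `Q ≤ 2`.
  have b1 : ‖Complex.exp ((t * ∑ k ∈ Finset.range m, x k : ℝ) * Complex.I)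
      - stoppedProd t x m * Real.exp (-(t ^ 2 / 2 * Q))‖ ≤ 4 * |t| ^ 3 * δ := by
    rw [e1, e2]
    refine (norm_prod_sub_prod_le_sum _ _ m (fun k _ => (Complex.norm_exp_ofReal_mul_I _).le)
      fun k _ => ?_).trans ?_
    · rw [norm_mul, ← Complex.ofReal_neg, Complex.norm_exp_ofReal, Real.exp_neg, ← div_eq_mul_inv]
      exact div_le_one_of_le₀ (norm_one_add_mul_I_le _) (Real.exp_pos _).le
    · calc ∑ k ∈ Finset.range m, ‖Complex.exp ((t * x k : ℝ) * Complex.I) -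
            (1 + (t * x k : ℝ) * Complex.I) * Complex.exp (-((t * x k) ^ 2 / 2 : ℝ))‖
          ≤ ∑ k ∈ Finset.range m, 2 * |t| ^ 3 * δ * x k ^ 2 := by
            refine Finset.sum_le_sum fun k hk => ?_
            have hk := Finset.mem_range.1 hk
            refine (norm_exp_mul_I_sub_le (htx k hk)).trans ?_
            rw [abs_mul, mul_pow, ← sq_abs (x k), pow_succ |x k| 2]
            have h3 : |x k| ^ 2 * |x k| ≤ |x k| ^ 2 * δ :=
              mul_le_mul_of_nonneg_left (hx k hk) (by positivity)
            have := mul_le_mul_of_nonneg_left h3 (by positivity : 0 ≤ 2 * |t| ^ 3)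
            nlinarith
        _ = 2 * |t| ^ 3 * δ * Q := by rw [← Finset.mul_sum]
        _ ≤ _ := by
            have : 0 ≤ 2 * |t| ^ 3 * δ := by positivity
            nlinarith
  have b2 : ‖stoppedProd t x m * Real.exp (-(t ^ 2 / 2 * Q))
      - stoppedProd t x m * Real.exp (-(t ^ 2 / 2))‖ ≤ Real.exp (t ^ 2) * t ^ 2 * δ := by
    rw [← mul_sub, norm_mul, ← Complex.ofReal_sub, Complex.norm_real, Real.norm_eq_abs, mul_assoc]
    refine mul_le_mul (norm_stoppedProd_le_exp t x m hQ2) ?_ (abs_nonneg _) (Real.exp_pos _).le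
    refine (abs_exp_neg_sub_exp_neg_le (by positivity) (by positivity)).trans ?_
    have : t ^ 2 / 2 * Q - t ^ 2 / 2 = t ^ 2 / 2 * (Q - 1) := by ring
    rw [this, abs_mul, abs_of_nonneg (by positivity)]
    nlinarith [sq_nonneg t, mul_le_mul_of_nonneg_left hQ (sq_nonneg t), abs_nonneg (Q - 1),
      mul_nonneg (sq_nonneg t) hδ0]
  rw [← sub_add_sub_cancel _ (stoppedProd t x m * Real.exp (-(t ^ 2 / 2 * Q)))]
  refine (norm_add_le _ _).trans ?_
  linarith

/-- The part of `|y|` above the level `δ`. -/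
noncomputable def absTail (δ y : ℝ) : ℝ := if δ < |y| then |y| else 0

theorem absTail_nonneg (δ y : ℝ) : 0 ≤ absTail δ y := by
  unfold absTail; split_ifs <;> positivity

/-- Holds with no condition on `x`: off the good event the crude product bound is paid for by the
indicator or by the tail sum. The right side needs only first moments to be integrable. -/
theorem norm_exp_sum_sub_stoppedProd_le (t : ℝ) (x : ℕ → ℝ) (m : ℕ) {δ : ℝ} (hδ0 : 0 < δ)
    (hδ : δ ≤ 1) (htδ : |t| * δ ≤ 1) :
    ‖Complex.exp ((t * ∑ k ∈ Finset.range m, x k : ℝ) * Complex.I)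
      - stoppedProd t x m * Real.exp (-(t ^ 2 / 2))‖ ≤
      (4 * |t| ^ 3 + Real.exp (t ^ 2) * t ^ 2) * δ +
      (1 + 2 * Real.exp (t ^ 2)) *
        Set.indicator {q : ℝ | δ ≤ |q - 1|} 1 (∑ i ∈ Finset.range m, x i ^ 2) +
      ((1 + 2 * Real.exp (t ^ 2)) / δ + Real.exp (t ^ 2) * |t|) *
        ∑ k ∈ Finset.range m, absTail δ (x k) := by
  set R := ∑ k ∈ Finset.range m, absTail δ (x k) with hR
  have he := Real.exp_pos (t ^ 2)
  have hR0 : 0 ≤ R := Finset.sum_nonneg fun _ _ => absTail_nonneg _ _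
  have hxR : ∀ k < m, absTail δ (x k) ≤ R := fun k hk =>
    Finset.single_le_sum (f := fun k => absTail δ (x k)) (fun _ _ => absTail_nonneg _ _)
      (Finset.mem_range.2 hk)
  have hI0 : 0 ≤ Set.indicator {q : ℝ | δ ≤ |q - 1|} (1 : ℝ → ℝ) (∑ i ∈ Finset.range m, x i ^ 2) :=
    Set.indicator_nonneg (fun _ _ => zero_le_one) _
  by_cases hgood : ¬ δ ≤ |∑ i ∈ Finset.range m, x i ^ 2 - 1| ∧ ∀ k < m, |x k| ≤ δ
  · have := norm_exp_sum_sub_stoppedProd_le_of_small t x m hδ htδ (not_le.1 hgood.1).le hgood.2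
    have h1 : 0 ≤ (1 + 2 * Real.exp (t ^ 2)) *
        Set.indicator {q : ℝ | δ ≤ |q - 1|} (1 : ℝ → ℝ) (∑ i ∈ Finset.range m, x i ^ 2) := by
      positivity
    have h2 : 0 ≤ ((1 + 2 * Real.exp (t ^ 2)) / δ + Real.exp (t ^ 2) * |t|) * R := by positivity
    linarith
  · have hM : ∀ k < m, |x k| ≤ δ + R := fun k hk => by
      have := hxR k hk
      unfold absTail at this
      split_ifs at this with h
      · linarith
      · linarith
    have hT := norm_stoppedProd_le t x m (by positivity) hM
    have hG : ‖Complex.exp ((t * ∑ k ∈ Finset.range m, x k : ℝ) * Complex.I)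
        - stoppedProd t x m * Real.exp (-(t ^ 2 / 2))‖ ≤
        1 + Real.exp (t ^ 2) * (1 + |t| * (δ + R)) := by
      refine (norm_sub_le _ _).trans ?_
      rw [Complex.norm_exp_ofReal_mul_I, norm_mul, Complex.norm_real, Real.norm_eq_abs,
        abs_of_pos (Real.exp_pos _)]
      have h1 : Real.exp (-(t ^ 2 / 2)) ≤ 1 := Real.exp_le_one_iff.2 (by nlinarith [sq_nonneg t])
      have := mul_le_mul hT h1 (Real.exp_pos _).le (by positivity)
      linarith
    -- A single term above `δ` already makes `R / δ ≥ 1`.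
    have hbad : 1 ≤ Set.indicator {q : ℝ | δ ≤ |q - 1|} (1 : ℝ → ℝ)
        (∑ i ∈ Finset.range m, x i ^ 2) + R / δ := by
      by_cases h : δ ≤ |∑ i ∈ Finset.range m, x i ^ 2 - 1|
      · rw [Set.indicator_of_mem (by exact h)]
        have : 0 ≤ R / δ := by positivity
        simpa using this
      · have : ∃ k < m, δ < |x k| := by
          by_contra! hc
          exact hgood ⟨h, hc⟩
        obtain ⟨k, hk, hkδ⟩ := this
        have h1 := hxR k hk
        rw [absTail, if_pos hkδ] at h1
        have : 1 ≤ R / δ := by rw [le_div_iff₀ hδ0]; linarith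
        linarith
    have h0 : 0 ≤ (4 * |t| ^ 3 + Real.exp (t ^ 2) * t ^ 2) * δ := by positivity
    have h3 := mul_le_mul_of_nonneg_left hbad (by positivity : 0 ≤ 1 + 2 * Real.exp (t ^ 2))
    have h4 : (1 + 2 * Real.exp (t ^ 2)) * (R / δ) = (1 + 2 * Real.exp (t ^ 2)) / δ * R := by ring
    -- This absorption turns `1 + e^{t²} (1 + |t| δ)` into the constant `1 + 2 e^{t²}`.
    have h5 : Real.exp (t ^ 2) * (|t| * δ) ≤ Real.exp (t ^ 2) := by nlinarith
    nlinarith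

/-- Iterated limit: the index goes to its limit for fixed `δ`, then `δ → 0`. The point is that `K`
does not depend on `δ`, while `v` may. -/
theorem tendsto_zero_of_eventually_le_mul_add {ι : Type*} {l : Filter ι} {u : ι → ℝ}
    (h0 : ∀ n, 0 ≤ u n) {K δ₀ : ℝ} (hδ₀ : 0 < δ₀)
    (h : ∀ δ, 0 < δ → δ ≤ δ₀ → ∃ v : ι → ℝ, Tendsto v l (𝓝 0) ∧ ∀ᶠ n in l, u n ≤ K * δ + v n) :
    Tendsto u l (𝓝 0) := by
  refine tendsto_order.2 ⟨fun a ha => Eventually.of_forall fun n => ha.trans_le (h0 n),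
    fun a ha => ?_⟩
  obtain ⟨v, hv, huv⟩ := h (min δ₀ (a / (2 * (|K| + 1)))) (by positivity) (min_le_left _ _)
  have hK : K * min δ₀ (a / (2 * (|K| + 1))) ≤ a / 2 := by
    calc K * min δ₀ (a / (2 * (|K| + 1))) ≤ (|K| + 1) * (a / (2 * (|K| + 1))) :=
          mul_le_mul (by linarith [le_abs_self K]) (min_le_right _ _) (by positivity)
            (by positivity)
      _ = a / 2 := by field_simp
  filter_upwards [huv, hv.eventually (gt_mem_nhds (half_pos ha))] with n h1 h2
  linarith

/-! ### Mean of the stopped product and the characteristic function. -/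

section McLeish

variable {Ω : Type*} [mΩ : MeasurableSpace Ω] {μ : Measure Ω}

theorem measurable_absTail (δ : ℝ) : Measurable (absTail δ) :=
  Measurable.ite (measurableSet_lt measurable_const measurable_id.abs) measurable_id.abs
    measurable_const

theorem absTail_le_abs (δ y : ℝ) : absTail δ y ≤ |y| := by
  unfold absTail; split_ifs
  · exact le_rfl
  · positivity

theorem integrable_absTail {X : Ω → ℝ} (hX : Integrable X μ) (δ : ℝ) :
    Integrable (fun ω => absTail δ (X ω)) μ := by
  refine hX.mono ((measurable_absTail δ).comp_aemeasurable hX.aemeasurable).aestronglyMeasurable ?_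
  filter_upwards with ω
  rw [Real.norm_eq_abs, abs_of_nonneg (absTail_nonneg _ _)]
  exact absTail_le_abs _ _

variable [IsProbabilityMeasure μ]

theorem integral_mul_eq_zero_of_condExp {m : MeasurableSpace Ω} (hm : m ≤ mΩ) {Z : Ω → ℂ}
    {X : Ω → ℝ} (hZ : StronglyMeasurable[m] Z) {C : ℝ} (hC : ∀ ω, ‖Z ω‖ ≤ C)
    (hX : Integrable X μ) (hX0 : μ[X | m] =ᵐ[μ] 0) : ∫ ω, Z ω * X ω ∂μ = 0 := by
  -- Multiplication of a complex by a real number as a real bilinear map, so that the pull-out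
  -- property covers complex `Z` and real `X`.
  let B : ℂ →L[ℝ] ℝ →L[ℝ] ℂ := (ContinuousLinearMap.lsmul ℝ ℝ).flip
  have hB : ∀ z x, B z x = z * x := fun z x => by
    simp [B, mul_comm]
  have h := condExp_stronglyMeasurable_bilin_of_bound B hm hZ hX C (ae_of_all _ hC)
  simp only [hB] at h
  rw [← integral_condExp hm, integral_congr_ae h]
  refine integral_eq_zero_of_ae ?_
  filter_upwards [hX0] with ω hω
  simp [hω]

theorem measurable_stoppedTerm {Ω : Type*} {m : MeasurableSpace Ω} {X : ℕ → Ω → ℝ} {k : ℕ}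
    (hX : ∀ j ≤ k, Measurable[m] (X j)) : Measurable[m] fun ω => stoppedTerm (fun j => X j ω) k := by
  unfold stoppedTerm
  refine Measurable.ite (measurableSet_le ?_ measurable_const) (hX k le_rfl) measurable_const
  exact Finset.measurable_fun_sum _ fun j hj => (hX j (Finset.mem_range.1 hj).le).pow_const _

theorem measurable_stoppedProd {Ω : Type*} {m : MeasurableSpace Ω} {X : ℕ → Ω → ℝ} (t : ℝ) {k : ℕ}
    (hX : ∀ j < k, Measurable[m] (X j)) :
    Measurable[m] fun ω => stoppedProd t (fun j => X j ω) k := by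
  unfold stoppedProd
  refine Finset.measurable_fun_prod _ fun j hj => ?_
  have := measurable_stoppedTerm (m := m) (X := X) (k := j)
    fun i hi => hX i (hi.trans_lt (Finset.mem_range.1 hj))
  fun_prop

variable {𝒢 : Filtration ℕ mΩ} {X : ℕ → Ω → ℝ}

theorem integrable_stoppedProd (hm : ∀ k, Measurable (X k)) (hint : ∀ k, Integrable (X k) μ)
    (t : ℝ) (m : ℕ) : Integrable (fun ω => stoppedProd t (fun k => X k ω) m) μ := by
  have hb : Integrable (fun ω => Real.exp (t ^ 2) *
      (1 + |t| * ∑ k ∈ Finset.range m, |X k ω|)) μ :=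
    ((integrable_const _).add ((integrable_finsetSum _ fun k _ => (hint k).abs).const_mul _)).const_mul _
  refine hb.mono' (measurable_stoppedProd t fun j _ => hm j).aestronglyMeasurable ?_
  filter_upwards with ω
  exact norm_stoppedProd_le t _ m (Finset.sum_nonneg fun _ _ => abs_nonneg _) fun k hk =>
    Finset.single_le_sum (f := fun k => |X k ω|) (fun _ _ => abs_nonneg _) (Finset.mem_range.2 hk)

theorem integral_stoppedProd (hX : ∀ k, StronglyMeasurable[𝒢 (k + 1)] (X k))
    (hint : ∀ k, Integrable (X k) μ) (hX0 : ∀ k, μ[X k | 𝒢 k] =ᵐ[μ] 0) (t : ℝ) (m : ℕ) :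
    ∫ ω, stoppedProd t (fun k => X k ω) m ∂μ = 1 := by
  have hm : ∀ k, Measurable (X k) := fun k => ((hX k).mono (𝒢.le _)).measurable
  induction m with
  | zero => simp [stoppedProd]
  | succ m ih =>
    have hmeas : ∀ j < m, Measurable[𝒢 m] (X j) := fun j hj =>
      ((hX j).mono (𝒢.mono (by omega))).measurable
    -- The increment of the product is `Z * X m`. The product itself may be unbounded, but on the
    -- event where stopping has not occurred it is at most `e^{t²}`, so `Z` is bounded and can be
    -- pulled out.
    let Z : Ω → ℂ := fun ω =>
      if ∑ i ∈ Finset.range m, X i ω ^ 2 ≤ 2 then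
        stoppedProd t (fun k => X k ω) m * (t * Complex.I) else 0
    have hZ : StronglyMeasurable[𝒢 m] Z := by
      refine Measurable.stronglyMeasurable ?_
      refine Measurable.ite (measurableSet_le ?_ measurable_const) ?_ measurable_const
      · exact Finset.measurable_fun_sum _ fun j hj => (hmeas j (Finset.mem_range.1 hj)).pow_const _
      · exact (measurable_stoppedProd t hmeas).mul_const _
    have hZb : ∀ ω, ‖Z ω‖ ≤ Real.exp (t ^ 2) * |t| := fun ω => by
      simp only [Z]
      split_ifs with h
      · rw [norm_mul, norm_mul, Complex.norm_I, mul_one, Complex.norm_real, Real.norm_eq_abs]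
        gcongr
        exact norm_stoppedProd_le_exp t _ m h
      · simp; positivity
    have hstep : ∀ ω, stoppedProd t (fun k => X k ω) (m + 1) =
        stoppedProd t (fun k => X k ω) m + Z ω * X m ω := fun ω => by
      have : stoppedProd t (fun k => X k ω) (m + 1) = stoppedProd t (fun k => X k ω) m *
          (1 + (t * stoppedTerm (fun k => X k ω) m : ℝ) * Complex.I) := Finset.prod_range_succ _ _
      rw [this]
      simp only [Z, stoppedTerm]
      split_ifs
      · push_cast; ring
      · simp
    simp_rw [hstep]
    have hZX : Integrable (fun ω => Z ω * X m ω) μ :=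
      (hint m).ofReal.bdd_mul (hZ.mono (𝒢.le m)).aestronglyMeasurable (ae_of_all _ hZb)
    rw [integral_add (integrable_stoppedProd hm hint t m) hZX, ih,
      integral_mul_eq_zero_of_condExp (𝒢.le m) hZ hZb (hint m) (hX0 m), add_zero]

/-- Distance of the characteristic function of a sum of martingale differences from that of the
standard normal law. -/
theorem norm_integral_exp_sum_sub_le (hX : ∀ k, StronglyMeasurable[𝒢 (k + 1)] (X k))
    (hint : ∀ k, Integrable (X k) μ) (hX0 : ∀ k, μ[X k | 𝒢 k] =ᵐ[μ] 0) (t : ℝ) (m : ℕ) {δ : ℝ}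
    (hδ0 : 0 < δ) (hδ : δ ≤ 1) (htδ : |t| * δ ≤ 1) :
    ‖∫ ω, Complex.exp ((t * ∑ k ∈ Finset.range m, X k ω : ℝ) * Complex.I) ∂μ
      - Real.exp (-(t ^ 2 / 2))‖ ≤
      (4 * |t| ^ 3 + Real.exp (t ^ 2) * t ^ 2) * δ +
      (1 + 2 * Real.exp (t ^ 2)) * μ.real {ω | δ ≤ |∑ i ∈ Finset.range m, X i ω ^ 2 - 1|} +
      ((1 + 2 * Real.exp (t ^ 2)) / δ + Real.exp (t ^ 2) * |t|) *
        ∑ k ∈ Finset.range m, ∫ ω, absTail δ (X k ω) ∂μ := by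
  have hm : ∀ k, Measurable (X k) := fun k => ((hX k).mono (𝒢.le _)).measurable
  have hTint := integrable_stoppedProd hm hint t m
  have hQm : Measurable fun ω => ∑ i ∈ Finset.range m, X i ω ^ 2 :=
    Finset.measurable_fun_sum _ fun j _ => (hm j).pow_const _
  have hset : MeasurableSet {ω | δ ≤ |∑ i ∈ Finset.range m, X i ω ^ 2 - 1|} :=
    measurableSet_le measurable_const (hQm.sub_const 1).abs
  have hEint : Integrable (fun ω =>
      Complex.exp ((t * ∑ k ∈ Finset.range m, X k ω : ℝ) * Complex.I)) μ := by
    refine Integrable.of_bound (C := 1) (Measurable.aestronglyMeasurable ?_)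
      (ae_of_all _ fun ω => (Complex.norm_exp_ofReal_mul_I _).le)
    have : Measurable fun ω => ∑ k ∈ Finset.range m, X k ω :=
      Finset.measurable_fun_sum _ fun j _ => hm j
    fun_prop
  have hsub : ∫ ω, Complex.exp ((t * ∑ k ∈ Finset.range m, X k ω : ℝ) * Complex.I) ∂μ
      - Real.exp (-(t ^ 2 / 2)) =
      ∫ ω, (Complex.exp ((t * ∑ k ∈ Finset.range m, X k ω : ℝ) * Complex.I)
        - stoppedProd t (fun k => X k ω) m * Real.exp (-(t ^ 2 / 2))) ∂μ := by
    rw [integral_sub hEint (hTint.mul_const _), integral_mul_const,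
      integral_stoppedProd hX hint hX0, one_mul]
  rw [hsub]
  have hi1 : Integrable (Set.indicator {ω | δ ≤ |∑ i ∈ Finset.range m, X i ω ^ 2 - 1|}
      (1 : Ω → ℝ)) μ := (integrable_const (1 : ℝ)).indicator hset
  have hi2 : Integrable (fun ω => ∑ k ∈ Finset.range m, absTail δ (X k ω)) μ :=
    integrable_finsetSum _ fun k _ => integrable_absTail (hint k) δ
  calc _ ≤ ∫ ω, ((4 * |t| ^ 3 + Real.exp (t ^ 2) * t ^ 2) * δ +
        (1 + 2 * Real.exp (t ^ 2)) *
          Set.indicator {ω | δ ≤ |∑ i ∈ Finset.range m, X i ω ^ 2 - 1|} (1 : Ω → ℝ) ω +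
        ((1 + 2 * Real.exp (t ^ 2)) / δ + Real.exp (t ^ 2) * |t|) *
          ∑ k ∈ Finset.range m, absTail δ (X k ω)) ∂μ := by
        refine norm_integral_le_of_norm_le
          (((integrable_const _).add (hi1.const_mul _)).add (hi2.const_mul _)) ?_
        filter_upwards with ω
        exact norm_exp_sum_sub_stoppedProd_le t (fun k => X k ω) m hδ0 hδ htδ
    _ = _ := by
        have hc : Integrable (fun _ : Ω => (4 * |t| ^ 3 + Real.exp (t ^ 2) * t ^ 2) * δ) μ :=
          integrable_const _
        rw [integral_add (f := fun ω => _ + _) (hc.add (hi1.const_mul _)) (hi2.const_mul _),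
          integral_add hc (hi1.const_mul _), integral_const_mul,
          integral_const_mul, integral_const_mul, integral_indicator_one hset,
          integral_finsetSum _ fun k _ => integrable_absTail (hint k) δ]
        simp

end McLeish

/-- **McLeish's central limit theorem** for triangular arrays of martingale differences. -/
theorem tendstoInDistribution_sum_of_martingaleDifference {Ω : Type*} [mΩ : MeasurableSpace Ω]
    {μ : Measure Ω} [IsProbabilityMeasure μ] {𝒢 : Filtration ℕ mΩ} {X : ℕ → ℕ → Ω → ℝ} {m : ℕ → ℕ}
    (hX : ∀ n k, StronglyMeasurable[𝒢 (k + 1)] (X n k))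
    (hint : ∀ n k, Integrable (X n k) μ) (hX0 : ∀ n k, μ[X n k | 𝒢 k] =ᵐ[μ] 0)
    (htail : ∀ δ, 0 < δ → δ ≤ 1 → Tendsto
      (fun n => ∑ k ∈ Finset.range (m n), ∫ ω, absTail δ (X n k ω) ∂μ) atTop (𝓝 0))
    (hsq : TendstoInMeasure μ (fun n ω => ∑ k ∈ Finset.range (m n), X n k ω ^ 2) atTop
      fun _ => 1) :
    TendstoInDistribution (fun n ω => ∑ k ∈ Finset.range (m n), X n k ω) atTop (id : ℝ → ℝ)
      (fun _ => μ) (gaussianReal 0 1) := by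
  have hmeas : ∀ n, Measurable fun ω => ∑ k ∈ Finset.range (m n), X n k ω := fun n =>
    Finset.measurable_fun_sum _ fun j _ => ((hX n j).mono (𝒢.le _)).measurable
  refine ⟨fun n => (hmeas n).aemeasurable, aemeasurable_id, ?_⟩
  refine ProbabilityMeasure.tendsto_iff_tendsto_charFun.2 fun t => ?_
  have hlim : charFun ((gaussianReal 0 1).map id) t = Real.exp (-(t ^ 2 / 2)) := by
    rw [Measure.map_id, charFun_gaussianReal]
    simp
  have hchar : ∀ n, charFun (μ.map fun ω => ∑ k ∈ Finset.range (m n), X n k ω) t =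
      ∫ ω, Complex.exp ((t * ∑ k ∈ Finset.range (m n), X n k ω : ℝ) * Complex.I) ∂μ := fun n => by
    rw [charFun_apply_real, integral_map (hmeas n).aemeasurable (by fun_prop)]
    push_cast; rfl
  change Tendsto (fun n => charFun (μ.map fun ω => ∑ k ∈ Finset.range (m n), X n k ω) t) atTop
    (𝓝 (charFun ((gaussianReal 0 1).map id) t))
  rw [hlim]
  simp_rw [hchar]
  rw [tendsto_iff_norm_sub_tendsto_zero]
  refine tendsto_zero_of_eventually_le_mul_add (fun n => norm_nonneg _)
    -- This `δ₀` secures both `δ ≤ 1` and `|t| * δ ≤ 1`.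
    (K := 4 * |t| ^ 3 + Real.exp (t ^ 2) * t ^ 2) (δ₀ := 1 / (1 + |t|)) (by positivity)
    fun δ hδ0 hδ => ?_
  have ht := abs_nonneg t
  rw [le_div_iff₀ (by positivity)] at hδ
  have hδ1 : δ ≤ 1 := by nlinarith
  have h1 := (tendstoInMeasure_iff_measureReal_norm.1 hsq δ hδ0).const_mul
    (1 + 2 * Real.exp (t ^ 2))
  have h2 := (htail δ hδ0 hδ1).const_mul
    ((1 + 2 * Real.exp (t ^ 2)) / δ + Real.exp (t ^ 2) * |t|)
  refine ⟨_, by simpa using h1.add h2, Eventually.of_forall fun n => ?_⟩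
  have := norm_integral_exp_sum_sub_le (hX n) (hint n) (hX0 n) t (m n) hδ0 hδ1 (by nlinarith)
  simpa [add_assoc] using this

/-! ### Truncated moments, slow variation and the Karamata estimate. -/

section TruncatedMoments

variable {Ω : Type*} [mΩ : MeasurableSpace Ω] {μ : Measure Ω} {X : Ω → ℝ}

theorem truncSq_nonneg {Ω : Type*} (X : Ω → ℝ) (x : ℝ) (ω : Ω) : 0 ≤ truncSq X x ω :=
  Set.indicator_nonneg (fun _ _ => sq_nonneg _) _

theorem truncSq_le_sq {Ω : Type*} (X : Ω → ℝ) (x : ℝ) (ω : Ω) : truncSq X x ω ≤ x ^ 2 := by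
  refine Set.indicator_apply_le' (fun h => ?_) fun _ => sq_nonneg _
  rw [← sq_abs]
  exact pow_le_pow_left₀ (abs_nonneg _) h 2

theorem truncSq_le_mul_abs {Ω : Type*} (X : Ω → ℝ) {x : ℝ} (hx : 0 ≤ x) (ω : Ω) :
    truncSq X x ω ≤ x * |X ω| := by
  refine Set.indicator_apply_le' (fun h => ?_) fun _ => by positivity
  rw [← sq_abs, sq]
  exact mul_le_mul_of_nonneg_right h (abs_nonneg _)

theorem truncSq_mono {Ω : Type*} (X : Ω → ℝ) {x y : ℝ} (hxy : x ≤ y) (ω : Ω) :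
    truncSq X x ω ≤ truncSq X y ω :=
  Set.indicator_le_indicator_of_subset (fun _ h => le_trans (by exact h) hxy)
    (fun _ => sq_nonneg _) _

theorem measurable_truncSq (hX : Measurable X) (x : ℝ) : Measurable (truncSq X x) :=
  (hX.pow_const 2).indicator (measurableSet_le hX.abs measurable_const)

theorem memLp_truncSq [IsFiniteMeasure μ] (hX : Measurable X) (x : ℝ) (p : ENNReal) :
    MemLp (truncSq X x) p μ := by
  refine MemLp.of_bound (measurable_truncSq hX x).aestronglyMeasurable (x ^ 2) ?_
  filter_upwards with ω
  rw [Real.norm_eq_abs, abs_of_nonneg (truncSq_nonneg _ _ _)]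
  exact truncSq_le_sq _ _ _

theorem integrable_truncSq [IsFiniteMeasure μ] (hX : Measurable X) (x : ℝ) :
    Integrable (truncSq X x) μ :=
  memLp_one_iff_integrable.1 (memLp_truncSq hX x 1)

theorem truncMoment_nonneg (μ : Measure Ω) (X : Ω → ℝ) (x : ℝ) : 0 ≤ truncMoment μ X x :=
  integral_nonneg fun _ => truncSq_nonneg _ _ _

theorem monotone_truncMoment [IsFiniteMeasure μ] (hX : Measurable X) :
    Monotone (truncMoment μ X) := fun _ _ h =>
  integral_mono (integrable_truncSq hX _) (integrable_truncSq hX _) (truncSq_mono X h)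

theorem truncMoment_le_mul [IsFiniteMeasure μ] (hX : Measurable X) (hint : Integrable X μ) {x : ℝ}
    (hx : 0 ≤ x) : truncMoment μ X x ≤ x * ∫ ω, |X ω| ∂μ := by
  rw [← integral_const_mul]
  exact integral_mono (integrable_truncSq hX _) (hint.abs.const_mul _) (truncSq_le_mul_abs X hx)

theorem truncMoment_eq_of_identDistrib {Y : Ω → ℝ} (h : IdentDistrib Y X μ μ) (x : ℝ) :
    truncMoment μ Y x = truncMoment μ X x := by
  have hm : Measurable (Set.indicator {y : ℝ | |y| ≤ x} fun y => y ^ 2) :=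
    (measurable_id.pow_const 2).indicator (measurableSet_le measurable_id.abs measurable_const)
  exact (h.comp hm).integral_eq

theorem exists_one_lt_truncMoment [IsFiniteMeasure μ] (hX : Measurable X)
    (hinf : ∫⁻ ω, ENNReal.ofReal (X ω ^ 2) ∂μ = ⊤) : ∃ x, 0 ≤ x ∧ 1 < truncMoment μ X x := by
  have h := lintegral_tendsto_of_tendsto_of_monotone (μ := μ)
    (f := fun (n : ℕ) ω => ENNReal.ofReal (truncSq X n ω))
    (F := fun ω => ENNReal.ofReal (X ω ^ 2))
    (fun n => (measurable_truncSq hX n).ennreal_ofReal.aemeasurable)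
    (ae_of_all _ fun ω n k hnk => ENNReal.ofReal_le_ofReal (truncSq_mono X (by exact_mod_cast hnk) ω))
    (ae_of_all _ fun ω => by
      refine tendsto_const_nhds.congr' ?_
      filter_upwards [eventually_ge_atTop ⌈|X ω|⌉₊] with n hn
      rw [truncSq, Set.indicator_of_mem]
      exact Nat.ceil_le.1 hn)
  rw [hinf] at h
  obtain ⟨n, hn⟩ := (h.eventually (lt_mem_nhds ENNReal.one_lt_top)).exists
  refine ⟨n, n.cast_nonneg, ?_⟩
  rw [← ofReal_integral_eq_lintegral_ofReal (integrable_truncSq hX _)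
    (ae_of_all _ (truncSq_nonneg X _))] at hn
  exact (ENNReal.one_lt_ofReal).1 hn

theorem truncLevel_nonneg (μ : Measure Ω) (X : Ω → ℝ) : 0 ≤ truncLevel μ X :=
  Real.sInf_nonneg fun _ h => h.1

theorem one_le_truncH [IsFiniteMeasure μ] (hX : Measurable X)
    (hinf : ∫⁻ ω, ENNReal.ofReal (X ω ^ 2) ∂μ = ⊤) (x : ℝ) : 1 ≤ truncH μ X x := by
  obtain ⟨y, hy, hlt⟩ := exists_lt_of_csInf_lt (exists_one_lt_truncMoment hX hinf)
    (lt_add_one (truncLevel μ X))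
  exact hy.2.le.trans (monotone_truncMoment hX (hlt.le.trans (le_max_right _ _)))

theorem monotone_truncH [IsFiniteMeasure μ] (hX : Measurable X) : Monotone (truncH μ X) :=
  fun _ _ h => monotone_truncMoment hX (max_le_max_right _ h)

theorem truncH_eq_truncMoment {x : ℝ} (hx : truncLevel μ X + 1 ≤ x) :
    truncH μ X x = truncMoment μ X x := by
  rw [truncH, max_eq_left hx]

/-- Linear growth of `H` makes the normalizing sum vanish as `s → ∞`, so the infimum defining the
normalizer is over a nonempty set. -/
theorem truncH_le [IsFiniteMeasure μ] (hX : Measurable X) (hint : Integrable X μ) {x : ℝ}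
    (hx : 0 ≤ x) : truncH μ X x ≤ (truncLevel μ X + 1 + x) * ∫ ω, |X ω| ∂μ := by
  have hb := truncLevel_nonneg μ X
  refine (truncMoment_le_mul hX hint (hx.trans (le_max_left _ _))).trans ?_
  refine mul_le_mul_of_nonneg_right (max_le (by linarith) (by linarith)) ?_
  exact integral_nonneg fun _ => abs_nonneg _

/-- One dyadic step: on `x < |X| ≤ 2x` one has `x |X| ≤ X²`. -/
theorem mul_integral_absTail_le [IsFiniteMeasure μ] (hX : Measurable X) (hint : Integrable X μ)
    {x : ℝ} (hx : 0 ≤ x) : x * ∫ ω, absTail x (X ω) ∂μ ≤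
      truncMoment μ X (2 * x) - truncMoment μ X x + x * ∫ ω, absTail (2 * x) (X ω) ∂μ := by
  have h1 := integrable_truncSq (μ := μ) hX (2 * x)
  have h2 := integrable_truncSq (μ := μ) hX x
  have h3 := (integrable_absTail hint (2 * x)).const_mul x
  rw [truncMoment, truncMoment, ← integral_const_mul, ← integral_const_mul, ← integral_sub' h1 h2,
    ← integral_add (h1.sub h2) h3]
  refine integral_mono ((integrable_absTail hint x).const_mul x) ((h1.sub h2).add h3) fun ω => ?_
  have h0 := abs_nonneg (X ω)
  simp only [truncSq, absTail, Set.indicator, Set.mem_ofPred_eq, Pi.sub_apply]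
  rw [← sq_abs (X ω)]
  split_ifs <;> nlinarith

theorem tendsto_integral_absTail (hint : Integrable X μ) :
    Tendsto (fun x => ∫ ω, absTail x (X ω) ∂μ) atTop (𝓝 0) := by
  have := tendsto_integral_filter_of_dominated_convergence (μ := μ) (l := (atTop : Filter ℝ))
    (F := fun x ω => absTail x (X ω)) (f := fun _ => (0 : ℝ)) (fun ω => |X ω|)
    (Eventually.of_forall fun x => (integrable_absTail hint x).aestronglyMeasurable)
    (Eventually.of_forall fun x => ae_of_all _ fun ω => by
      rw [Real.norm_eq_abs, abs_of_nonneg (absTail_nonneg _ _)]; exact absTail_le_abs _ _)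
    hint.abs (ae_of_all _ fun ω => by
      refine tendsto_const_nhds.congr' ?_
      filter_upwards [eventually_ge_atTop |X ω|] with x hx
      rw [absTail, if_neg (not_lt.2 hx)])
  simpa using this

theorem IsSlowlyVarying.eventually_mul_le {L : ℝ → ℝ} (hL : IsSlowlyVarying L) {t : ℝ} (ht : 0 < t)
    {a : ℝ} (ha : a < 1) : ∀ᶠ x in atTop, a * L x ≤ L (t * x) := by
  filter_upwards [hL.1, (hL.2 t ht).eventually (lt_mem_nhds ha)] with x h1 h2
  exact ((lt_div_iff₀ h1).1 h2).le

theorem IsSlowlyVarying.eventually_le_mul {L : ℝ → ℝ} (hL : IsSlowlyVarying L) {t : ℝ} (ht : 0 < t)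
    {a : ℝ} (ha : 1 < a) : ∀ᶠ x in atTop, L (t * x) ≤ a * L x := by
  filter_upwards [hL.1, (hL.2 t ht).eventually (gt_mem_nhds ha)] with x h1 h2
  exact ((div_lt_iff₀ h1).1 h2).le

/-- A Karamata type estimate: if the truncated second moment varies slowly, then
`x E(|X| I(|X| > x)) = o(E(X² I(|X| ≤ x)))`. -/
theorem eventually_mul_integral_absTail_le [IsFiniteMeasure μ] (hX : Measurable X)
    (hint : Integrable X μ) (hL : IsSlowlyVarying (truncMoment μ X)) {η : ℝ} (hη : 0 < η) :
    ∀ᶠ x in atTop, x * ∫ ω, absTail x (X ω) ∂μ ≤ η * truncMoment μ X x := by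
  -- The induction closes because `κ + 2κ(1 + κ) ≤ 4κ`, which is `κ ≤ 1/2`; the factor 2 is half of
  -- `4`, the hypothesis at `2 * x` being halved.
  set κ := min (η / 4) (1 / 2) with hκ
  have hκ0 : 0 < κ := by positivity
  have hκ1 : κ ≤ 1 / 2 := min_le_right _ _
  have hκ2 : 4 * κ ≤ η := by have := min_le_left (η / 4) (1 / 2 : ℝ); linarith
  obtain ⟨x₀, hx₀⟩ := eventually_atTop.1
    (hL.eventually_le_mul (t := 2) two_pos (a := 1 + κ) (by linarith))
  have key : ∀ (N : ℕ) (x : ℝ), 0 ≤ x → x₀ ≤ x → x * ∫ ω, absTail x (X ω) ∂μ ≤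
      4 * κ * truncMoment μ X x + x * ∫ ω, absTail (2 ^ N * x) (X ω) ∂μ := by
    intro N
    induction N with
    | zero =>
      intro x hx _
      have := mul_nonneg hκ0.le (truncMoment_nonneg μ X x)
      simp only [pow_zero, one_mul]
      linarith
    | succ N ih =>
      intro x hx hxx
      have h1 := mul_integral_absTail_le hX hint hx
      have h2 := ih (2 * x) (by linarith) (by linarith)
      have h3 := hx₀ x hxx
      have h4 := truncMoment_nonneg μ X x
      have h5 : (2 : ℝ) ^ N * (2 * x) = 2 ^ (N + 1) * x := by ring
      rw [h5] at h2
      have h6 := mul_le_mul_of_nonneg_left h3 hκ0.le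
      have h7 : κ * (κ * truncMoment μ X x) ≤ κ * (1 / 2 * truncMoment μ X x) :=
        mul_le_mul_of_nonneg_left (mul_le_mul_of_nonneg_right hκ1 h4) hκ0.le
      nlinarith
  filter_upwards [eventually_ge_atTop x₀, eventually_gt_atTop 0] with x hx hx0
  -- The dyadic remainder disappears as `N → ∞` by integrability of `X`.
  have hlim : Tendsto (fun N : ℕ => 4 * κ * truncMoment μ X x +
      x * ∫ ω, absTail (2 ^ N * x) (X ω) ∂μ) atTop (𝓝 (4 * κ * truncMoment μ X x + x * 0)) := by
    refine tendsto_const_nhds.add (Tendsto.const_mul _ ?_)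
    exact (tendsto_integral_absTail hint).comp
      ((tendsto_pow_atTop_atTop_of_one_lt one_lt_two).atTop_mul_const hx0)
  have h := ge_of_tendsto' hlim fun N => key N x hx0.le hx
  have := mul_le_mul_of_nonneg_right hκ2 (truncMoment_nonneg μ X x)
  linarith

theorem mul_measureReal_lt_abs_le [IsFiniteMeasure μ] (hX : Measurable X) (hint : Integrable X μ)
    (x : ℝ) : x * μ.real {ω | x < |X ω|} ≤ ∫ ω, absTail x (X ω) ∂μ := by
  have hs : MeasurableSet {ω | x < |X ω|} := measurableSet_lt measurable_const hX.abs
  rw [← integral_indicator_one hs, ← integral_const_mul]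
  refine integral_mono (((integrable_const (1 : ℝ)).indicator hs).const_mul x)
    (integrable_absTail hint x) fun ω => ?_
  by_cases h : x < |X ω|
  · simp [absTail, h, h.le]
  · simp [absTail, h]

end TruncatedMoments

/-! ### The normalizer and the value of the normalized sum there. -/

section Normalizer

variable {H : ℝ → ℝ} {m : ℕ → ℕ} {c : ℕ → ℕ → ℝ} {n : ℕ}

theorem normTerm_nonneg (h0 : ∀ x, 0 ≤ H x) (s : ℝ) (k : ℕ) : 0 ≤ normTerm H c n s k :=
  mul_nonneg (by positivity) (h0 _)

/-- Since `s² * normTerm` is nondecreasing in `s`, this one-sided comparison replaces continuity of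
`H`, which may jump. -/
theorem normTerm_le_mul (hmono : Monotone H) {s s' : ℝ} (hs : 0 < s)
    (hss : s ≤ s') (k : ℕ) : normTerm H c n s k ≤ (s' / s) ^ 2 * normTerm H c n s' k := by
  have hs' : 0 < s' := hs.trans_le hss
  have h1 : H (s / |c n k|) ≤ H (s' / |c n k|) := hmono (by gcongr)
  calc normTerm H c n s k ≤ c n k ^ 2 / s ^ 2 * H (s' / |c n k|) :=
        mul_le_mul_of_nonneg_left h1 (by positivity)
    _ = _ := by unfold normTerm; field_simp

theorem sum_normTerm_le_mul (hmono : Monotone H) {s s' : ℝ} (hs : 0 < s)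
    (hss : s ≤ s') (t : Finset ℕ) :
    ∑ k ∈ t, normTerm H c n s k ≤ (s' / s) ^ 2 * ∑ k ∈ t, normTerm H c n s' k := by
  rw [Finset.mul_sum]
  exact Finset.sum_le_sum fun k _ => normTerm_le_mul hmono hs hss k

theorem tendsto_normTerm_atTop (h0 : ∀ x, 0 ≤ H x) {A B : ℝ}
    (hAB : ∀ x, 0 ≤ x → H x ≤ A + B * x) (k : ℕ) :
    Tendsto (fun s => normTerm H c n s k) atTop (𝓝 0) := by
  have hlim : Tendsto (fun s : ℝ => c n k ^ 2 * A * (s⁻¹ * s⁻¹) + |c n k| * B * s⁻¹) atTop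
      (𝓝 (c n k ^ 2 * A * (0 * 0) + |c n k| * B * 0)) :=
    ((tendsto_inv_atTop_zero.mul tendsto_inv_atTop_zero).const_mul _).add
      (tendsto_inv_atTop_zero.const_mul _)
  simp only [mul_zero, add_zero] at hlim
  refine squeeze_zero' (Eventually.of_forall fun s => normTerm_nonneg h0 s k) ?_ hlim
  filter_upwards [eventually_gt_atTop 0] with s hs
  by_cases hc : c n k = 0
  · simp [normTerm, hc]
  have hc' : 0 < |c n k| := abs_pos.2 hc
  refine (mul_le_mul_of_nonneg_left (hAB (s / |c n k|) (by positivity)) (by positivity)).trans_eq ?_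
  rw [← sq_abs (c n k)]
  field_simp

theorem normalizer_set_nonempty (h0 : ∀ x, 0 ≤ H x) {A B : ℝ}
    (hAB : ∀ x, 0 ≤ x → H x ≤ A + B * x) (m : ℕ → ℕ) (c : ℕ → ℕ → ℝ) (n : ℕ) :
    {s : ℝ | 1 ≤ s ∧ ∑ k ∈ Finset.Icc 1 (m n), normTerm H c n s k ≤ 1}.Nonempty := by
  have h : Tendsto (fun s => ∑ k ∈ Finset.Icc 1 (m n), normTerm H c n s k) atTop
      (𝓝 (∑ k ∈ Finset.Icc 1 (m n), 0)) :=
    tendsto_finsetSum _ fun k _ => tendsto_normTerm_atTop h0 hAB k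
  rw [Finset.sum_const_zero] at h
  obtain ⟨s, h1, h2⟩ := ((h.eventually (gt_mem_nhds one_pos)).and (eventually_ge_atTop 1)).exists
  exact ⟨s, h2, h1.le⟩

theorem one_le_normalizer (h0 : ∀ x, 0 ≤ H x) {A B : ℝ}
    (hAB : ∀ x, 0 ≤ x → H x ≤ A + B * x) : 1 ≤ normalizer H m c n :=
  le_csInf (normalizer_set_nonempty h0 hAB m c n) fun _ h => h.1

theorem sum_normTerm_normalizer_le_one (hmono : Monotone H) (h0 : ∀ x, 0 ≤ H x) {A B : ℝ}
    (hAB : ∀ x, 0 ≤ x → H x ≤ A + B * x) :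
    ∑ k ∈ Finset.Icc 1 (m n), normTerm H c n (normalizer H m c n) k ≤ 1 := by
  set D := normalizer H m c n with hD
  have hD1 : 1 ≤ D := one_le_normalizer h0 hAB
  have hD0 : 0 < D := by linarith
  have hlim : Tendsto (fun a : ℝ => (a / D) ^ 2) (𝓝[>] D) (𝓝 ((D / D) ^ 2)) :=
    ((tendsto_id.div_const D).pow 2).mono_left nhdsWithin_le_nhds
  rw [div_self hD0.ne', one_pow] at hlim
  refine ge_of_tendsto hlim ?_
  filter_upwards [self_mem_nhdsWithin] with a ha
  obtain ⟨s, hs, hsa⟩ := exists_lt_of_csInf_lt (normalizer_set_nonempty h0 hAB m c n) ha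
  have hDs : D ≤ s := csInf_le ⟨1, fun _ h => h.1⟩ hs
  have h1 := sum_normTerm_le_mul (c := c) (n := n) hmono hD0 hDs (Finset.Icc 1 (m n))
  have h2 : (s / D) ^ 2 ≤ (a / D) ^ 2 :=
    pow_le_pow_left₀ (div_nonneg (by linarith) hD0.le) (by gcongr) 2
  have h3 := mul_le_mul_of_nonneg_left hs.2 (sq_nonneg (s / D))
  linarith

theorem one_le_sum_normTerm_normalizer (hmono : Monotone H)
    (hD : 1 < normalizer H m c n) :
    1 ≤ ∑ k ∈ Finset.Icc 1 (m n), normTerm H c n (normalizer H m c n) k := by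
  set D := normalizer H m c n with hDdef
  have hD0 : 0 < D := by linarith
  set F := ∑ k ∈ Finset.Icc 1 (m n), normTerm H c n D k with hF
  have hlim : Tendsto (fun a : ℝ => (D / a) ^ 2 * F) (𝓝[<] D) (𝓝 ((D / D) ^ 2 * F)) :=
    (((tendsto_const_nhds.div tendsto_id hD0.ne').pow 2).mul_const F).mono_left nhdsWithin_le_nhds
  rw [div_self hD0.ne', one_pow, one_mul] at hlim
  refine ge_of_tendsto hlim ?_
  filter_upwards [Ioo_mem_nhdsLT hD] with a ha
  have h1 := sum_normTerm_le_mul (c := c) (n := n) hmono (by linarith [ha.1]) ha.2.le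
    (Finset.Icc 1 (m n))
  have h2 : 1 < ∑ k ∈ Finset.Icc 1 (m n), normTerm H c n a k := by
    by_contra! h
    have hDa : normalizer H m c n ≤ a := csInf_le ⟨1, fun _ h => h.1⟩ ⟨ha.1.le, h⟩
    exact hDa.not_gt ha.2
  linarith

/-- If the normalizer exceeds 1 the sum there is exactly 1; nondegeneracy is needed only where the
normalizer equals 1. -/
theorem tendsto_sum_normTerm_normalizer (hmono : Monotone H) (h0 : ∀ x, 0 ≤ H x) {A B : ℝ}
    (hAB : ∀ x, 0 ≤ x → H x ≤ A + B * x)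
    (hnd : ∀ ε > 0, ∀ᶠ n in atTop, 1 - ε ≤ ∑ k ∈ Finset.Icc 1 (m n), normTerm H c n 1 k) :
    Tendsto (fun n => ∑ k ∈ Finset.Icc 1 (m n), normTerm H c n (normalizer H m c n) k) atTop
      (𝓝 1) := by
  refine tendsto_order.2 ⟨fun a ha => ?_, fun a ha => Eventually.of_forall fun n =>
    (sum_normTerm_normalizer_le_one hmono h0 hAB).trans_lt ha⟩
  filter_upwards [hnd ((1 - a) / 2) (by linarith)] with n hn
  rcases (one_le_normalizer (m := m) (c := c) (n := n) h0 hAB).eq_or_lt with h | h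
  · rw [← h]; linarith
  · exact ha.trans_le (one_le_sum_normTerm_normalizer hmono h)

theorem normTerm_eq_sq_mul (H : ℝ → ℝ) (c : ℕ → ℕ → ℝ) (n : ℕ) (s : ℝ) (k : ℕ) :
    normTerm H c n s k = (|c n k| / s) ^ 2 * H (|c n k| / s)⁻¹ := by
  rw [normTerm, inv_div, div_pow, sq_abs]

end Normalizer

/-! ### Variance and covariance bounds within one row. -/

section Row

variable {Ω : Type*} [mΩ : MeasurableSpace Ω] {μ : Measure Ω} {ξ : ℤ → Ω → ℝ}

theorem sum_dist_le_two_mul_tsum {f : ℕ → ℝ} (hf0 : ∀ i, 0 ≤ f i) (hf : Summable f) (s : Finset ℕ)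
    (j : ℕ) : ∑ k ∈ s.erase j, f (Nat.dist j k) ≤ 2 * ∑' i, f i := by
  have h : ∀ t : Finset ℕ, Set.InjOn (Nat.dist j) t →
      ∑ k ∈ t, f (Nat.dist j k) ≤ ∑' i, f i := fun t ht => by
    rw [← Finset.sum_image (f := f) ht]
    exact hf.sum_le_tsum _ fun i _ => hf0 i
  -- Each distance occurs at most once on either side of `j`, whence the factor 2.
  rw [← Finset.sum_filter_add_sum_filter_not _ (fun k => k < j), two_mul]
  refine add_le_add (h _ ?_) (h _ ?_)
  · intro a ha b hb hab
    simp only [Finset.coe_filter, Set.mem_ofPred_eq] at ha hb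
    simp only [Nat.dist] at hab
    omega
  · intro a ha b hb hab
    simp only [Finset.coe_filter, Set.mem_ofPred_eq] at ha hb
    simp only [Nat.dist] at hab
    omega

/-- A bound on covariances of truncated squares for ordered indices extends to all pairs of
distinct indices. -/
theorem sum_covariance_truncSq_le {B : ℕ → ℕ → ℝ} (hsymm : ∀ j k, B j k = B k j) {r u : ℕ → ℝ}
    (s : Finset ℕ)
    (h : ∀ j k, j < k → r j ^ 2 * r k ^ 2 * cov[truncSq (ξ j) (u j), truncSq (ξ k) (u k); μ] ≤ B j k) :
    ∑ j ∈ s, ∑ k ∈ s.erase j,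
      r j ^ 2 * r k ^ 2 * cov[truncSq (ξ j) (u j), truncSq (ξ k) (u k); μ] ≤
    ∑ j ∈ s, ∑ k ∈ s.erase j, B j k := by
  refine Finset.sum_le_sum fun j _ => Finset.sum_le_sum fun k hk => ?_
  rcases (Finset.ne_of_mem_erase hk).lt_or_gt with hkj | hkj
  · rw [hsymm, covariance_comm, mul_comm (r j ^ 2)]
    exact h k j hkj
  · exact h j k hkj

/-- The variance of a weighted sum of truncated squares. -/
theorem variance_sum_truncSq_le [IsProbabilityMeasure μ] (hξ : ∀ k, Measurable (ξ k))
    (hident : ∀ k, IdentDistrib (ξ k) (ξ 0) μ μ) {r : ℕ → ℝ} (hr : ∀ k, 0 ≤ r k) {ε : ℝ}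
    (hε0 : 0 < ε) (hε : ε ≤ 1) (s : Finset ℕ) :
    Var[fun ω => ∑ k ∈ s, r k ^ 2 * truncSq (ξ k) (ε * (r k)⁻¹) ω; μ] ≤
      ε ^ 2 * ∑ k ∈ s, r k ^ 2 * truncMoment μ (ξ 0) (r k)⁻¹ +
      ∑ j ∈ s, ∑ k ∈ s.erase j, r j ^ 2 * r k ^ 2 *
        cov[truncSq (ξ j) (ε * (r j)⁻¹), truncSq (ξ k) (ε * (r k)⁻¹); μ] := by
  have hL : ∀ k ∈ s, MemLp (fun ω => r k ^ 2 * truncSq (ξ k) (ε * (r k)⁻¹) ω) 2 μ := fun k _ =>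
    (memLp_truncSq (hξ k) _ 2).const_mul _
  have hcov : ∀ j k : ℕ, cov[fun ω => r j ^ 2 * truncSq (ξ j) (ε * (r j)⁻¹) ω,
      fun ω => r k ^ 2 * truncSq (ξ k) (ε * (r k)⁻¹) ω; μ] = r j ^ 2 * r k ^ 2 *
        cov[truncSq (ξ j) (ε * (r j)⁻¹), truncSq (ξ k) (ε * (r k)⁻¹); μ] := fun j k => by
    rw [covariance_const_mul_left, covariance_const_mul_right, mul_assoc]
  rw [variance_fun_sum' hL, Finset.mul_sum, ← Finset.sum_add_distrib]
  refine Finset.sum_le_sum fun j hj => ?_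
  rw [← Finset.add_sum_erase _ _ hj]
  simp_rw [hcov]
  refine add_le_add ?_ le_rfl
  -- For `r j = 0` the level is `ε * 0⁻¹ = 0`, but the weight `r j ^ 2` removes the term.
  rcases (hr j).eq_or_lt with h0 | h0
  · simp [← h0]
  rw [covariance_self (measurable_truncSq (hξ j) _).aemeasurable]
  have h1 : Var[truncSq (ξ j) (ε * (r j)⁻¹); μ] ≤
      (ε * (r j)⁻¹) ^ 2 * truncMoment μ (ξ 0) (r j)⁻¹ := by
    refine (variance_le_expectation_sq (measurable_truncSq (hξ j) _).aestronglyMeasurable).trans ?_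
    refine (integral_mono (g := fun ω => (ε * (r j)⁻¹) ^ 2 * truncSq (ξ j) (ε * (r j)⁻¹) ω)
      (memLp_truncSq (hξ j) _ 2).integrable_sq ((integrable_truncSq (hξ j) _).const_mul _)
      fun ω => ?_).trans ?_
    · change truncSq (ξ j) (ε * (r j)⁻¹) ω ^ 2 ≤ _
      rw [sq]
      exact mul_le_mul_of_nonneg_right (truncSq_le_sq _ _ _) (truncSq_nonneg _ _ _)
    · rw [integral_const_mul]
      refine mul_le_mul_of_nonneg_left ?_ (sq_nonneg _)
      change truncMoment μ (ξ j) _ ≤ _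
      rw [truncMoment_eq_of_identDistrib (hident j)]
      refine monotone_truncMoment (hξ 0) ?_
      exact mul_le_of_le_one_left (inv_nonneg.2 (hr j)) hε
  calc r j ^ 2 * r j ^ 2 * Var[truncSq (ξ j) (ε * (r j)⁻¹); μ]
      ≤ r j ^ 2 * r j ^ 2 * ((ε * (r j)⁻¹) ^ 2 * truncMoment μ (ξ 0) (r j)⁻¹) :=
        mul_le_mul_of_nonneg_left h1 (by positivity)
    _ = _ := by field_simp

/-- With `a = ε / r j` the factor `a²` cancels the weight `r j ^ 2`, leaving `ε² φ p k`, which is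
summed over the other index by summability of `φ`. The 4 is 2 from symmetrizing times 2 from the two
sides of an index. -/
theorem sum_covariance_truncSq_le_of_mixingM2 [IsProbabilityMeasure μ] (hξ : ∀ k, Measurable (ξ k))
    {φ : ℕ → ℝ} (hφ0 : ∀ k, 0 < φ k) (hφ : Summable φ)
    (hM : ∀ (j : ℤ) (k : ℕ), 1 ≤ k → ∀ a b : ℝ, 0 < a → 0 < b →
      cov[truncSq (ξ j) a, truncSq (ξ (j + k)) b; μ] ≤ a ^ 2 * φ k * truncMoment μ (ξ 0) b)
    {r : ℕ → ℝ} (hr : ∀ k, 0 ≤ r k) {ε : ℝ} (hε0 : 0 < ε) (hε : ε ≤ 1) (s : Finset ℕ) :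
    ∑ j ∈ s, ∑ k ∈ s.erase j, r j ^ 2 * r k ^ 2 *
        cov[truncSq (ξ j) (ε * (r j)⁻¹), truncSq (ξ k) (ε * (r k)⁻¹); μ] ≤
      4 * ε ^ 2 * (∑' i, φ i) * ∑ k ∈ s, r k ^ 2 * truncMoment μ (ξ 0) (r k)⁻¹ := by
  set p : ℕ → ℝ := fun k => r k ^ 2 * truncMoment μ (ξ 0) (r k)⁻¹ with hp
  have hp0 : ∀ k, 0 ≤ p k := fun k => mul_nonneg (sq_nonneg _) (truncMoment_nonneg _ _ _)
  refine (sum_covariance_truncSq_le (B := fun j k => ε ^ 2 * φ (Nat.dist j k) * (p j + p k))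
    (fun j k => by rw [Nat.dist_comm, add_comm (p j)]) s fun j k hjk => ?_).trans ?_
  · have hB : 0 ≤ ε ^ 2 * φ (Nat.dist j k) := mul_nonneg (sq_nonneg _) (hφ0 _).le
    rcases (hr j).eq_or_lt with h0 | hj
    · simpa [← h0] using mul_nonneg hB (add_nonneg (hp0 j) (hp0 k))
    rcases (hr k).eq_or_lt with h0 | hk
    · simpa [← h0] using mul_nonneg hB (add_nonneg (hp0 j) (hp0 k))
    have h := hM j (k - j) (by omega) (ε * (r j)⁻¹) (ε * (r k)⁻¹) (by positivity) (by positivity)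
    have e1 : (j : ℤ) + ((k - j : ℕ) : ℤ) = k := by omega
    have e2 : Nat.dist j k = k - j := Nat.dist_eq_sub_of_le hjk.le
    have h3 : truncMoment μ (ξ 0) (ε * (r k)⁻¹) ≤ truncMoment μ (ξ 0) (r k)⁻¹ :=
      monotone_truncMoment (hξ 0) (mul_le_of_le_one_left (by positivity) hε)
    rw [e1] at h
    rw [e2] at hB ⊢
    calc _ ≤ r j ^ 2 * r k ^ 2 * ((ε * (r j)⁻¹) ^ 2 * φ (k - j) *
            truncMoment μ (ξ 0) (ε * (r k)⁻¹)) := mul_le_mul_of_nonneg_left h (by positivity)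
      _ = ε ^ 2 * φ (k - j) * (r k ^ 2 * truncMoment μ (ξ 0) (ε * (r k)⁻¹)) := by field_simp
      _ ≤ ε ^ 2 * φ (k - j) * p k :=
          mul_le_mul_of_nonneg_left (mul_le_mul_of_nonneg_left h3 (sq_nonneg _)) hB
      _ ≤ _ := mul_le_mul_of_nonneg_left (by linarith [hp0 j]) hB
  · have hswap : ∑ j ∈ s, ∑ k ∈ s.erase j, ε ^ 2 * φ (Nat.dist j k) * p k =
        ∑ j ∈ s, ∑ k ∈ s.erase j, ε ^ 2 * φ (Nat.dist j k) * p j := by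
      rw [Finset.sum_comm' (t' := s) (s' := fun k => s.erase k)]
      · simp_rw [Nat.dist_comm]
      · intro j k
        simp only [Finset.mem_erase]
        tauto
    simp_rw [mul_add, Finset.sum_add_distrib]
    rw [hswap, ← two_mul, Finset.mul_sum, Finset.mul_sum]
    refine Finset.sum_le_sum fun j _ => ?_
    have h := sum_dist_le_two_mul_tsum (fun i => (hφ0 i).le) hφ s j
    have : ∑ k ∈ s.erase j, ε ^ 2 * φ (Nat.dist j k) * p j =
        ε ^ 2 * p j * ∑ k ∈ s.erase j, φ (Nat.dist j k) := by
      rw [Finset.mul_sum]; exact Finset.sum_congr rfl fun _ _ => by ring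
    rw [this]
    nlinarith [mul_le_mul_of_nonneg_left h (mul_nonneg (sq_nonneg ε) (hp0 j))]

/-- As `ψ` need not be summable, it is split into a small constant `θ` and a summable `f`. The `θ`
part costs at most `θ (∑ p)²`; in the `f` part one factor `p k` is replaced by the row maximum. -/
theorem sum_covariance_truncSq_le_of_mixingM1 [IsProbabilityMeasure μ] (hξ : ∀ k, Measurable (ξ k))
    {ψ : ℕ → ℝ} (hψ0 : ∀ k, 0 < ψ k)
    (hM : ∀ (j : ℤ) (k : ℕ), 1 ≤ k → ∀ a b : ℝ, 0 < a → 0 < b →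
      cov[truncSq (ξ j) a, truncSq (ξ (j + k)) b; μ] ≤
        ψ k * truncMoment μ (ξ 0) b * truncMoment μ (ξ 0) a)
    {θ : ℝ} (hθ : 0 ≤ θ) {f : ℕ → ℝ} (hf0 : ∀ i, 0 ≤ f i) (hf : Summable f)
    (hψf : ∀ i, ψ i ≤ θ + f i)
    {r : ℕ → ℝ} (hr : ∀ k, 0 ≤ r k) {ε : ℝ} (hε0 : 0 < ε) (hε : ε ≤ 1) (s : Finset ℕ) {M : ℝ}
    (hrM : ∀ k ∈ s, r k ^ 2 * truncMoment μ (ξ 0) (r k)⁻¹ ≤ M)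
    (hsum : ∑ k ∈ s, r k ^ 2 * truncMoment μ (ξ 0) (r k)⁻¹ ≤ 1) :
    ∑ j ∈ s, ∑ k ∈ s.erase j, r j ^ 2 * r k ^ 2 *
        cov[truncSq (ξ j) (ε * (r j)⁻¹), truncSq (ξ k) (ε * (r k)⁻¹); μ] ≤
      θ + 2 * |M| * ∑' i, f i := by
  set p : ℕ → ℝ := fun k => r k ^ 2 * truncMoment μ (ξ 0) (r k)⁻¹ with hp
  have hp0 : ∀ k, 0 ≤ p k := fun k => mul_nonneg (sq_nonneg _) (truncMoment_nonneg _ _ _)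
  refine (sum_covariance_truncSq_le (B := fun j k => ψ (Nat.dist j k) * (p j * p k))
    (fun j k => by rw [Nat.dist_comm, mul_comm (p j)]) s fun j k hjk => ?_).trans ?_
  · have hB := mul_nonneg (hψ0 (Nat.dist j k)).le (mul_nonneg (hp0 j) (hp0 k))
    rcases (hr j).eq_or_lt with h0 | hj
    · simpa [← h0] using hB
    rcases (hr k).eq_or_lt with h0 | hk
    · simpa [← h0] using hB
    have h := hM j (k - j) (by omega) (ε * (r j)⁻¹) (ε * (r k)⁻¹) (by positivity) (by positivity)
    have e1 : (j : ℤ) + ((k - j : ℕ) : ℤ) = k := by omega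
    have e2 : Nat.dist j k = k - j := Nat.dist_eq_sub_of_le hjk.le
    have h3 : ∀ i, truncMoment μ (ξ 0) (ε * (r i)⁻¹) ≤ truncMoment μ (ξ 0) (r i)⁻¹ := fun i =>
      monotone_truncMoment (hξ 0) (mul_le_of_le_one_left (inv_nonneg.2 (hr i)) hε)
    have h4 : ∀ i, r i ^ 2 * truncMoment μ (ξ 0) (ε * (r i)⁻¹) ≤ p i := fun i =>
      mul_le_mul_of_nonneg_left (h3 i) (sq_nonneg _)
    rw [e1] at h
    rw [e2]
    calc _ ≤ r j ^ 2 * r k ^ 2 * (ψ (k - j) * truncMoment μ (ξ 0) (ε * (r k)⁻¹) *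
            truncMoment μ (ξ 0) (ε * (r j)⁻¹)) := mul_le_mul_of_nonneg_left h (by positivity)
      _ = ψ (k - j) * ((r j ^ 2 * truncMoment μ (ξ 0) (ε * (r j)⁻¹)) *
            (r k ^ 2 * truncMoment μ (ξ 0) (ε * (r k)⁻¹))) := by ring
      _ ≤ _ := mul_le_mul_of_nonneg_left (mul_le_mul (h4 j) (h4 k)
          (mul_nonneg (sq_nonneg _) (truncMoment_nonneg _ _ _)) (hp0 j)) (hψ0 _).le
  · have hin : ∀ j ∈ s, ∑ k ∈ s.erase j, ψ (Nat.dist j k) * (p j * p k) ≤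
        p j * (θ + 2 * |M| * ∑' i, f i) := fun j _ => by
      have h1 : ∑ k ∈ s.erase j, ψ (Nat.dist j k) * p k ≤
          ∑ k ∈ s.erase j, (θ * p k + |M| * f (Nat.dist j k)) := by
        refine Finset.sum_le_sum fun k hk => ?_
        have hk' : p k ≤ |M| := (hrM k (Finset.mem_of_mem_erase hk)).trans (le_abs_self M)
        have h2 := mul_le_mul_of_nonneg_right (hψf (Nat.dist j k)) (hp0 k)
        have h3 := mul_le_mul_of_nonneg_left hk' (hf0 (Nat.dist j k))
        linarith
      have h2 : ∑ k ∈ s.erase j, p k ≤ 1 :=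
        (Finset.sum_le_sum_of_subset_of_nonneg (Finset.erase_subset _ _)
          fun k _ _ => hp0 k).trans hsum
      rw [Finset.sum_add_distrib, ← Finset.mul_sum, ← Finset.mul_sum] at h1
      have h3 := mul_le_mul_of_nonneg_left h2 hθ
      have h4 := mul_le_mul_of_nonneg_left (sum_dist_le_two_mul_tsum hf0 hf s j) (abs_nonneg M)
      have h5 : ∑ k ∈ s.erase j, ψ (Nat.dist j k) * (p j * p k) =
          p j * ∑ k ∈ s.erase j, ψ (Nat.dist j k) * p k := by
        rw [Finset.mul_sum]; exact Finset.sum_congr rfl fun _ _ => by ring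
      rw [h5]
      exact mul_le_mul_of_nonneg_left (by linarith) (hp0 j)
    refine (Finset.sum_le_sum hin).trans ?_
    rw [← Finset.sum_mul]
    refine mul_le_of_le_one_left ?_ hsum
    have : 0 ≤ ∑' i, f i := tsum_nonneg hf0
    positivity

end Row

/-! ### Limits along the rows: tails, means, variances. -/

section Array

variable {Ω : Type*} [mΩ : MeasurableSpace Ω] {μ : Measure Ω} {ξ : ℤ → Ω → ℝ} {m : ℕ → ℕ}
  {r : ℕ → ℕ → ℝ}

theorem integral_absTail_eq_of_identDistrib {X Y : Ω → ℝ} (h : IdentDistrib Y X μ μ) (x : ℝ) :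
    ∫ ω, absTail x (Y ω) ∂μ = ∫ ω, absTail x (X ω) ∂μ :=
  (h.comp (measurable_absTail x)).integral_eq

theorem absTail_mul {a : ℝ} (ha : a ≠ 0) (δ y : ℝ) :
    absTail δ (a * y) = |a| * absTail (δ * |a|⁻¹) y := by
  have ha' : 0 < |a| := abs_pos.2 ha
  have h : δ * |a|⁻¹ < |y| ↔ δ < |a * y| := by
    rw [abs_mul, ← div_eq_mul_inv, div_lt_iff₀ ha', mul_comm]
  simp only [absTail, h, abs_mul]
  split_ifs <;> simp

/-- The condition that all arguments `(r n k)⁻¹` tend to infinity, uniformly in `k`. -/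
def RowsNegligible (r : ℕ → ℕ → ℝ) (m : ℕ → ℕ) : Prop :=
  ∀ p : ℝ → Prop, (∀ᶠ x in atTop, p x) →
    ∀ᶠ n in atTop, ∀ k ∈ Finset.Icc 1 (m n), r n k ≠ 0 → p (r n k)⁻¹

variable [IsProbabilityMeasure μ]

theorem RowsNegligible.eventually_mul_integral_absTail_le (hrow : RowsNegligible r m)
    (hr : ∀ n k, 0 ≤ r n k)
    (hξ : ∀ k, Measurable (ξ k)) (hint : ∀ k, Integrable (ξ k) μ)
    (hident : ∀ k, IdentDistrib (ξ k) (ξ 0) μ μ) (hL : IsSlowlyVarying (truncMoment μ (ξ 0)))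
    {δ : ℝ} (hδ0 : 0 < δ) (hδ : δ ≤ 1) {η : ℝ} (hη : 0 < η) :
    ∀ᶠ n in atTop, ∀ k ∈ Finset.Icc 1 (m n), r n k ≠ 0 →
      r n k * ∫ ω, absTail (δ * (r n k)⁻¹) (ξ k ω) ∂μ ≤
        η * δ⁻¹ * (r n k ^ 2 * truncMoment μ (ξ 0) (r n k)⁻¹) := by
  have hev := (tendsto_id.const_mul_atTop hδ0).eventually
    (_root_.eventually_mul_integral_absTail_le (hξ 0) (hint 0) hL hη)
  filter_upwards [hrow _ hev] with n hn k hk hne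
  have h := hn k hk hne
  simp only [id] at h
  have hr0 : 0 < r n k := (hr n k).lt_of_ne' hne
  have hmono : truncMoment μ (ξ 0) (δ * (r n k)⁻¹) ≤ truncMoment μ (ξ 0) (r n k)⁻¹ :=
    monotone_truncMoment (hξ 0) (mul_le_of_le_one_left (by positivity) hδ)
  have h2 := h.trans (mul_le_mul_of_nonneg_left hmono hη.le)
  rw [integral_absTail_eq_of_identDistrib (hident k)]
  calc r n k * ∫ ω, absTail (δ * (r n k)⁻¹) (ξ 0 ω) ∂μ
      = (r n k ^ 2 * δ⁻¹) * (δ * (r n k)⁻¹ * ∫ ω, absTail (δ * (r n k)⁻¹) (ξ 0 ω) ∂μ) := by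
        field_simp
    _ ≤ (r n k ^ 2 * δ⁻¹) * (η * truncMoment μ (ξ 0) (r n k)⁻¹) :=
        mul_le_mul_of_nonneg_left h2 (by positivity)
    _ = _ := by ring

theorem RowsNegligible.tendsto_sum_integral_absTail (hrow : RowsNegligible r m)
    (hr : ∀ n k, 0 ≤ r n k)
    (hξ : ∀ k, Measurable (ξ k)) (hint : ∀ k, Integrable (ξ k) μ)
    (hident : ∀ k, IdentDistrib (ξ k) (ξ 0) μ μ) (hL : IsSlowlyVarying (truncMoment μ (ξ 0)))
    (hsum : ∀ᶠ n in atTop,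
      ∑ k ∈ Finset.Icc 1 (m n), r n k ^ 2 * truncMoment μ (ξ 0) (r n k)⁻¹ ≤ 1)
    {a : ℕ → ℕ → ℝ} (ha : ∀ n k, |a n k| = r n k) {δ : ℝ} (hδ0 : 0 < δ) (hδ : δ ≤ 1) :
    Tendsto (fun n => ∑ k ∈ Finset.Icc 1 (m n), ∫ ω, absTail δ (a n k * ξ k ω) ∂μ) atTop
      (𝓝 0) := by
  refine tendsto_zero_of_eventually_le_mul_add (K := δ⁻¹) (δ₀ := 1)
    (fun n => Finset.sum_nonneg fun k _ => integral_nonneg fun _ => absTail_nonneg _ _) one_pos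
    fun η hη _ => ⟨0, tendsto_const_nhds, ?_⟩
  filter_upwards [hsum, hrow.eventually_mul_integral_absTail_le hr hξ hint hident hL hδ0 hδ hη]
    with n h1 h2
  calc ∑ k ∈ Finset.Icc 1 (m n), ∫ ω, absTail δ (a n k * ξ k ω) ∂μ
      ≤ ∑ k ∈ Finset.Icc 1 (m n),
          η * δ⁻¹ * (r n k ^ 2 * truncMoment μ (ξ 0) (r n k)⁻¹) := by
        refine Finset.sum_le_sum fun k hk => ?_
        by_cases h0 : a n k = 0
        · have h0' : r n k = 0 := by rw [← ha, h0, abs_zero]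
          simp [h0, h0', absTail, hδ0.not_gt]
        · simp_rw [absTail_mul h0, integral_const_mul, ha]
          exact h2 k hk (by rw [← ha]; exact abs_ne_zero.2 h0)
    _ ≤ δ⁻¹ * η + 0 := by
        rw [← Finset.mul_sum]
        have := mul_le_mul_of_nonneg_left h1 (by positivity : 0 ≤ η * δ⁻¹)
        linarith

/-- Markov's inequality on the tail integrals. Indices with `r n k = 0` are excluded since their
level would be `0`, not infinity. -/
theorem RowsNegligible.tendsto_sum_measureReal (hrow : RowsNegligible r m)
    (hr : ∀ n k, 0 ≤ r n k)
    (hξ : ∀ k, Measurable (ξ k)) (hint : ∀ k, Integrable (ξ k) μ)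
    (hident : ∀ k, IdentDistrib (ξ k) (ξ 0) μ μ) (hL : IsSlowlyVarying (truncMoment μ (ξ 0)))
    (hsum : ∀ᶠ n in atTop,
      ∑ k ∈ Finset.Icc 1 (m n), r n k ^ 2 * truncMoment μ (ξ 0) (r n k)⁻¹ ≤ 1)
    {ε : ℝ} (hε0 : 0 < ε) (hε : ε ≤ 1) :
    Tendsto (fun n => ∑ k ∈ Finset.Icc 1 (m n) with r n k ≠ 0,
      μ.real {ω | ε * (r n k)⁻¹ < |ξ k ω|}) atTop (𝓝 0) := by
  have h := (hrow.tendsto_sum_integral_absTail hr hξ hint hident hL hsum (a := r)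
    (fun n k => abs_of_nonneg (hr n k)) hε0 hε).const_mul ε⁻¹
  rw [mul_zero] at h
  refine squeeze_zero (fun n => Finset.sum_nonneg fun _ _ => measureReal_nonneg) (fun n => ?_) h
  rw [Finset.mul_sum]
  refine (Finset.sum_le_sum fun k hk => ?_).trans
    (Finset.sum_le_sum_of_subset_of_nonneg (Finset.filter_subset _ _) fun k _ _ => ?_)
  · have hne := (Finset.mem_filter.1 hk).2
    have hr0 : 0 < r n k := (hr n k).lt_of_ne' hne
    simp_rw [absTail_mul hne, integral_const_mul, abs_of_pos hr0]
    have := mul_measureReal_lt_abs_le (hξ k) (hint k) (ε * (r n k)⁻¹)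
    calc μ.real {ω | ε * (r n k)⁻¹ < |ξ k ω|}
        = ε⁻¹ * (r n k * (ε * (r n k)⁻¹ * μ.real {ω | ε * (r n k)⁻¹ < |ξ k ω|})) := by field_simp
      _ ≤ _ := by gcongr
  · exact mul_nonneg (inv_nonneg.2 hε0.le) (integral_nonneg fun _ => absTail_nonneg _ _)

/-- Shrinking the level by the fixed factor `ε` costs a ratio tending to one by slow variation,
uniformly along the row; the upper bound is monotonicity. -/
theorem RowsNegligible.tendsto_sum_truncMoment (hrow : RowsNegligible r m)
    (hr : ∀ n k, 0 ≤ r n k)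
    (hξ : ∀ k, Measurable (ξ k)) (hL : IsSlowlyVarying (truncMoment μ (ξ 0)))
    (hlim : Tendsto (fun n =>
      ∑ k ∈ Finset.Icc 1 (m n), r n k ^ 2 * truncMoment μ (ξ 0) (r n k)⁻¹) atTop (𝓝 1))
    {ε : ℝ} (hε0 : 0 < ε) (hε : ε ≤ 1) :
    Tendsto (fun n => ∑ k ∈ Finset.Icc 1 (m n),
      r n k ^ 2 * truncMoment μ (ξ 0) (ε * (r n k)⁻¹)) atTop (𝓝 1) := by
  refine tendsto_order.2 ⟨fun a ha => ?_, fun a ha => ?_⟩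
  · set b := (1 + a) / 2 with hb
    have h1 := hlim.const_mul b
    rw [mul_one] at h1
    filter_upwards [h1.eventually (lt_mem_nhds (by linarith : a < b)),
      hrow _ (hL.eventually_mul_le hε0 (by linarith : b < 1))] with n h2 h3
    refine h2.trans_le ?_
    rw [Finset.mul_sum]
    refine Finset.sum_le_sum fun k hk => ?_
    by_cases h0 : r n k = 0
    · simp [h0]
    · have := mul_le_mul_of_nonneg_left (h3 k hk h0) (sq_nonneg (r n k))
      linarith
  · filter_upwards [hlim.eventually (gt_mem_nhds ha)] with n hn
    refine (Finset.sum_le_sum fun k _ => ?_).trans_lt hn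
    exact mul_le_mul_of_nonneg_left (monotone_truncMoment (hξ 0)
      (mul_le_of_le_one_left (inv_nonneg.2 (hr n k)) hε)) (sq_nonneg _)

/-- Under either mixing condition the variance of the sum of truncated squares is small. -/
theorem exists_variance_sum_truncSq_le (hr : ∀ n k, 0 ≤ r n k)
    (hξ : ∀ k, Measurable (ξ k)) (hident : ∀ k, IdentDistrib (ξ k) (ξ 0) μ μ)
    (hmix : MixingM1 μ ξ ∨ MixingM2 μ ξ) {M : ℕ → ℝ} (hM : Tendsto M atTop (𝓝 0))
    (hrM : ∀ᶠ n in atTop, ∀ k ∈ Finset.Icc 1 (m n),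
      r n k ^ 2 * truncMoment μ (ξ 0) (r n k)⁻¹ ≤ M n)
    (hsum : ∀ᶠ n in atTop,
      ∑ k ∈ Finset.Icc 1 (m n), r n k ^ 2 * truncMoment μ (ξ 0) (r n k)⁻¹ ≤ 1) :
    ∃ K : ℝ, ∀ ε, 0 < ε → ε ≤ 1 → ∃ v : ℕ → ℝ, Tendsto v atTop (𝓝 0) ∧ ∀ᶠ n in atTop,
      Var[fun ω => ∑ k ∈ Finset.Icc 1 (m n), r n k ^ 2 * truncSq (ξ k) (ε * (r n k)⁻¹) ω; μ] ≤
        K * ε + v n := by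
  rcases hmix with ⟨ψ, hψ0, hψ, hM1⟩ | ⟨φ, hφ0, hφ, hM2⟩
  · refine ⟨2, fun ε hε0 hε => ?_⟩
    obtain ⟨N, hN⟩ := eventually_atTop.1 (hψ.eventually (gt_mem_nhds hε0))
    -- The finitely many lags where `ψ` may exceed `ε`; their contribution vanishes with the row
    -- maximum `M n`.
    set f : ℕ → ℝ := fun i => if i < N then ψ i else 0 with hf
    have hf0 : ∀ i, 0 ≤ f i := fun i => by
      simp only [hf]; split_ifs
      · exact (hψ0 i).le
      · exact le_rfl
    have hfs : Summable f := summable_of_ne_finset_zero (s := Finset.range N) fun i hi => by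
      simp only [hf, if_neg (fun h => hi (Finset.mem_range.2 h))]
    have hψf : ∀ i, ψ i ≤ ε + f i := fun i => by
      simp only [hf]; split_ifs with h
      · linarith
      · linarith [hN i (not_lt.1 h)]
    refine ⟨fun n => 2 * |M n| * ∑' i, f i, ?_, ?_⟩
    · simpa using ((hM.abs).const_mul 2).mul_const (∑' i, f i)
    · filter_upwards [hrM, hsum] with n h1 h2
      have h3 := variance_sum_truncSq_le hξ hident (hr n) hε0 hε (Finset.Icc 1 (m n))
      have h4 := sum_covariance_truncSq_le_of_mixingM1 hξ hψ0 hM1 hε0.le hf0 hfs hψf (hr n) hε0 hε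
        (Finset.Icc 1 (m n)) h1 h2
      have h5 := mul_le_mul_of_nonneg_left h2 (sq_nonneg ε)
      nlinarith
  · refine ⟨1 + 4 * ∑' i, φ i, fun ε hε0 hε => ⟨0, tendsto_const_nhds, ?_⟩⟩
    have hΦ : 0 ≤ ∑' i, φ i := tsum_nonneg fun i => (hφ0 i).le
    filter_upwards [hsum] with n h2
    have h3 := variance_sum_truncSq_le hξ hident (hr n) hε0 hε (Finset.Icc 1 (m n))
    have h4 := sum_covariance_truncSq_le_of_mixingM2 hξ hφ0 hφ hM2 (hr n) hε0 hε
      (Finset.Icc 1 (m n))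
    have h5 := mul_le_mul_of_nonneg_left h2 (sq_nonneg ε)
    have h6 := mul_le_mul_of_nonneg_left h2 (by positivity : 0 ≤ 4 * ε ^ 2 * ∑' i, φ i)
    have h7 : ε ^ 2 ≤ ε := by nlinarith
    have h8 := mul_le_mul_of_nonneg_right h7 hΦ
    simp only [Pi.zero_apply]
    nlinarith

theorem RowsNegligible.tendstoInMeasure_sum_sq (hrow : RowsNegligible r m)
    (hr : ∀ n k, 0 ≤ r n k)
    (hξ : ∀ k, Measurable (ξ k)) (hint : ∀ k, Integrable (ξ k) μ)
    (hident : ∀ k, IdentDistrib (ξ k) (ξ 0) μ μ) (hL : IsSlowlyVarying (truncMoment μ (ξ 0)))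
    (hmix : MixingM1 μ ξ ∨ MixingM2 μ ξ) {M : ℕ → ℝ} (hM : Tendsto M atTop (𝓝 0))
    (hrM : ∀ᶠ n in atTop, ∀ k ∈ Finset.Icc 1 (m n),
      r n k ^ 2 * truncMoment μ (ξ 0) (r n k)⁻¹ ≤ M n)
    (hsum : ∀ᶠ n in atTop,
      ∑ k ∈ Finset.Icc 1 (m n), r n k ^ 2 * truncMoment μ (ξ 0) (r n k)⁻¹ ≤ 1)
    (hlim : Tendsto (fun n =>
      ∑ k ∈ Finset.Icc 1 (m n), r n k ^ 2 * truncMoment μ (ξ 0) (r n k)⁻¹) atTop (𝓝 1)) :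
    TendstoInMeasure μ (fun n ω => ∑ k ∈ Finset.Icc 1 (m n), r n k ^ 2 * ξ k ω ^ 2) atTop
      fun _ => 1 := by
  obtain ⟨K, hK⟩ := exists_variance_sum_truncSq_le hr hξ hident hmix hM hrM hsum
  refine tendstoInMeasure_iff_measureReal_norm.2 fun δ hδ => ?_
  refine tendsto_zero_of_eventually_le_mul_add (K := K / (δ / 2) ^ 2) (δ₀ := 1)
    (fun n => measureReal_nonneg) one_pos fun ε hε0 hε => ?_
  obtain ⟨v, hv, hvar⟩ := hK ε hε0 hε
  refine ⟨fun n => (∑ k ∈ Finset.Icc 1 (m n) with r n k ≠ 0,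
      μ.real {ω | ε * (r n k)⁻¹ < |ξ k ω|}) + v n / (δ / 2) ^ 2, ?_, ?_⟩
  · simpa using (hrow.tendsto_sum_measureReal hr hξ hint hident hL hsum hε0 hε).add
      (hv.div_const ((δ / 2) ^ 2))
  have hmean := (hrow.tendsto_sum_truncMoment hr hξ hL hlim hε0 hε).eventually
    (Metric.ball_mem_nhds 1 (half_pos hδ))
  filter_upwards [hvar, hmean] with n h1 h2
  set S : Ω → ℝ := fun ω => ∑ k ∈ Finset.Icc 1 (m n),
    r n k ^ 2 * truncSq (ξ k) (ε * (r n k)⁻¹) ω with hS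
  have hSL : MemLp S 2 μ := memLp_finsetSum _ fun k _ => (memLp_truncSq (hξ k) _ 2).const_mul _
  have hES : μ[S] = ∑ k ∈ Finset.Icc 1 (m n),
      r n k ^ 2 * truncMoment μ (ξ 0) (ε * (r n k)⁻¹) := by
    refine (integral_finsetSum (f := fun (k : ℕ) ω => r n k ^ 2 * truncSq (ξ k) (ε * (r n k)⁻¹) ω) _
      fun k _ => (integrable_truncSq (hξ k) _).const_mul _).trans ?_
    refine Finset.sum_congr rfl fun k _ => ?_
    rw [integral_const_mul, ← truncMoment_eq_of_identDistrib (hident k), truncMoment]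
  rw [← hES, Real.dist_eq] at h2
  have hcheb : μ.real {ω | δ / 2 ≤ |S ω - μ[S]|} ≤ Var[S; μ] / (δ / 2) ^ 2 := by
    have h := meas_ge_le_variance_div_sq hSL (half_pos hδ)
    exact ENNReal.toReal_le_of_le_ofReal (div_nonneg (variance_nonneg _ _) (sq_nonneg _)) h
  -- When no term exceeds its level the sum equals `S`; as the mean of `S` is within `δ / 2` of 1,
  -- `S` deviates from its mean by at least `δ / 2`.
  have hsub : {ω | δ ≤ ‖∑ k ∈ Finset.Icc 1 (m n), r n k ^ 2 * ξ k ω ^ 2 - 1‖} ⊆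
      (⋃ k ∈ (Finset.Icc 1 (m n)).filter fun k => r n k ≠ 0,
        {ω | ε * (r n k)⁻¹ < |ξ k ω|}) ∪ {ω | δ / 2 ≤ |S ω - μ[S]|} := by
    intro ω hω
    by_cases hbad : ∃ k ∈ Finset.Icc 1 (m n), r n k ≠ 0 ∧ ε * (r n k)⁻¹ < |ξ k ω|
    · obtain ⟨k, hk, hne, hlt⟩ := hbad
      exact Or.inl (Set.mem_biUnion (Finset.mem_filter.2 ⟨hk, hne⟩) hlt)
    · push Not at hbad
      right
      have hSω : S ω = ∑ k ∈ Finset.Icc 1 (m n), r n k ^ 2 * ξ k ω ^ 2 := by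
        refine Finset.sum_congr rfl fun k hk => ?_
        by_cases h0 : r n k = 0
        · simp [h0]
        · rw [truncSq, Set.indicator_of_mem]
          exact hbad k hk h0
      change δ ≤ ‖_‖ at hω
      change δ / 2 ≤ |S ω - μ[S]|
      rw [← hSω, Real.norm_eq_abs] at hω
      have := abs_add_le (S ω - μ[S]) (μ[S] - 1)
      rw [sub_add_sub_cancel] at this
      linarith
  have h3 : μ.real {ω | δ ≤ ‖∑ k ∈ Finset.Icc 1 (m n), r n k ^ 2 * ξ k ω ^ 2 - 1‖} ≤
      (∑ k ∈ Finset.Icc 1 (m n) with r n k ≠ 0, μ.real {ω | ε * (r n k)⁻¹ < |ξ k ω|}) +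
        Var[S; μ] / (δ / 2) ^ 2 :=
    (measureReal_mono hsub).trans ((measureReal_union_le _ _).trans
      (add_le_add (measureReal_biUnion_finset_le _ _) hcheb))
  have h4 : Var[S; μ] / (δ / 2) ^ 2 ≤ (K * ε + v n) / (δ / 2) ^ 2 := by gcongr
  calc _ ≤ _ := h3
    _ ≤ _ := add_le_add le_rfl h4
    _ = _ := by ring

end Array

/-! ### Assembly of the theorem. -/

theorem sum_range_add_one_eq_sum_Icc (f : ℕ → ℝ) (m : ℕ) :
    ∑ k ∈ Finset.range m, f (k + 1) = ∑ k ∈ Finset.Icc 1 m, f k := by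
  induction m with
  | zero => simp
  | succ m ih => rw [Finset.sum_range_succ, ih, Finset.sum_Icc_succ_top (by omega)]

/-- In the first hypothesis on the coefficients, `⨆` over the finite set `{1, …, m n}` is the
maximum (and `0` if `m n = 0`). -/
theorem mainTheorem9 {Ω : Type*} [mΩ : MeasurableSpace Ω] (μ : Measure Ω) [IsProbabilityMeasure μ]
    (ℱ : Filtration ℤ mΩ) (ξ : ℤ → Ω → ℝ)
    (hmart : IsMartingaleDifference ℱ μ ξ)
    (hident : ∀ k, IdentDistrib (ξ k) (ξ 0) μ μ)
    (hinfinite : ∫⁻ ω, ENNReal.ofReal (ξ 0 ω ^ 2) ∂μ = ⊤)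
    (hDA : IsSlowlyVarying (truncMoment μ (ξ 0)))
    (m : ℕ → ℕ) (c : ℕ → ℕ → ℝ) (H : ℝ → ℝ) (D : ℕ → ℝ)
    (hH : H = truncH μ (ξ 0)) (hD : D = normalizer H m c)
    (hmax : Tendsto (fun n => ⨆ k : Finset.Icc 1 (m n), normTerm H c n (D n) k) atTop (𝓝 0)) :
    (TendstoInMeasure μ
        (fun n ω => 1 / D n ^ 2 * ∑ k ∈ Finset.Icc 1 (m n), c n k ^ 2 * ξ k ω ^ 2)
        atTop (fun _ => 1) →
      TendstoInDistribution
        (fun n ω => 1 / D n * ∑ k ∈ Finset.Icc 1 (m n), c n k * ξ k ω)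
        atTop (id : ℝ → ℝ) (fun _ => μ) (gaussianReal 0 1)) ∧
    ((∀ ε > 0, ∀ᶠ n in atTop, 1 - ε ≤ ∑ k ∈ Finset.Icc 1 (m n), normTerm H c n 1 k) →
      MixingM1 μ ξ ∨ MixingM2 μ ξ →
      TendstoInMeasure μ
        (fun n ω => 1 / D n ^ 2 * ∑ k ∈ Finset.Icc 1 (m n), c n k ^ 2 * ξ k ω ^ 2)
        atTop (fun _ => 1)) := by
  have hξ : ∀ k, Measurable (ξ k) := fun k => ((hmart.stronglyAdapted k).mono (ℱ.le k)).measurable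
  have hint := hmart.integrable
  have hmono : Monotone H := hH ▸ monotone_truncH (hξ 0)
  have hH1 : ∀ x, 1 ≤ H x := hH ▸ one_le_truncH (hξ 0) hinfinite
  have hH0 : ∀ x, 0 ≤ H x := fun x => zero_le_one.trans (hH1 x)
  have hAB : ∀ x, 0 ≤ x → H x ≤ (truncLevel μ (ξ 0) + 1) * (∫ ω, |ξ 0 ω| ∂μ) +
      (∫ ω, |ξ 0 ω| ∂μ) * x := fun x hx => by
    rw [hH]
    refine (truncH_le (hξ 0) (hint 0) hx).trans_eq (by ring)
  have hD1 : ∀ n, 1 ≤ D n := fun n => hD ▸ one_le_normalizer hH0 hAB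
  have hD0 : ∀ n, 0 < D n := fun n => one_pos.trans_le (hD1 n)
  set r : ℕ → ℕ → ℝ := fun n k => |c n k| / D n with hrdef
  have hr : ∀ n k, 0 ≤ r n k := fun n k => div_nonneg (abs_nonneg _) (hD0 n).le
  have hnt : ∀ n k, normTerm H c n (D n) k = r n k ^ 2 * H (r n k)⁻¹ := fun n k =>
    normTerm_eq_sq_mul H c n (D n) k
  have hle : ∀ n, ∀ k ∈ Finset.Icc 1 (m n), normTerm H c n (D n) k ≤
      ⨆ k : Finset.Icc 1 (m n), normTerm H c n (D n) k := fun n k hk =>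
    le_ciSup (f := fun k : Finset.Icc 1 (m n) => normTerm H c n (D n) k)
      (Set.finite_range _).bddAbove ⟨k, hk⟩
  have hrow : RowsNegligible r m := fun p hp => by
    obtain ⟨x₀, hx₀⟩ := eventually_atTop.1 (hp.and (eventually_gt_atTop 0))
    have hx0 : 0 < x₀ := (hx₀ x₀ le_rfl).2
    -- As `H ≥ 1`, a term below `x₀⁻²` forces `r n k < x₀⁻¹`.
    filter_upwards [hmax.eventually (gt_mem_nhds (by positivity : 0 < (x₀⁻¹) ^ 2))] with n hn k hk hne
    refine (hx₀ _ ?_).1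
    have hr0 : 0 < r n k := (hr n k).lt_of_ne' hne
    have h1 := (hle n k hk).trans_lt hn
    rw [hnt] at h1
    have h2 : r n k ^ 2 ≤ r n k ^ 2 * H (r n k)⁻¹ := le_mul_of_one_le_right (sq_nonneg _) (hH1 _)
    have h3 : r n k < x₀⁻¹ := lt_of_pow_lt_pow_left₀ 2 (by positivity) (h2.trans_lt h1)
    exact ((lt_inv_comm₀ hx0 hr0).2 h3).le
  have hHL : ∀ᶠ n in atTop, ∀ k ∈ Finset.Icc 1 (m n),
      normTerm H c n (D n) k = r n k ^ 2 * truncMoment μ (ξ 0) (r n k)⁻¹ := by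
    filter_upwards [hrow _ (eventually_ge_atTop (truncLevel μ (ξ 0) + 1))] with n hn k hk
    rw [hnt]
    by_cases h0 : r n k = 0
    · simp [h0]
    · rw [hH, truncH_eq_truncMoment (hn k hk h0)]
  have hsum : ∀ᶠ n in atTop,
      ∑ k ∈ Finset.Icc 1 (m n), r n k ^ 2 * truncMoment μ (ξ 0) (r n k)⁻¹ ≤ 1 := by
    filter_upwards [hHL] with n hn
    rw [← Finset.sum_congr rfl hn, hD]
    exact sum_normTerm_normalizer_le_one hmono hH0 hAB
  refine ⟨fun hsq => ?_, fun hnd hmix => ?_⟩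
  -- Index shift: `X n k` carries `ξ (k + 1)`, so it is measurable at time `k + 1` and centred given
  -- time `k`.
  · let 𝒢 : Filtration ℕ mΩ :=
      ⟨fun k => ℱ k, fun i j hij => ℱ.mono (by exact_mod_cast hij), fun k => ℱ.le k⟩
    let X : ℕ → ℕ → Ω → ℝ := fun n k ω => c n (k + 1) / D n * ξ ((k + 1 : ℕ) : ℤ) ω
    have hX1 : ∀ n ω, ∑ k ∈ Finset.range (m n), X n k ω =
        1 / D n * ∑ k ∈ Finset.Icc 1 (m n), c n k * ξ k ω := fun n ω => by
      rw [Finset.mul_sum, ← sum_range_add_one_eq_sum_Icc]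
      exact Finset.sum_congr rfl fun k _ => by simp only [X]; ring
    have hX2 : ∀ n ω, ∑ k ∈ Finset.range (m n), X n k ω ^ 2 =
        1 / D n ^ 2 * ∑ k ∈ Finset.Icc 1 (m n), c n k ^ 2 * ξ k ω ^ 2 := fun n ω => by
      rw [Finset.mul_sum, ← sum_range_add_one_eq_sum_Icc]
      exact Finset.sum_congr rfl fun k _ => by simp only [X]; ring
    simp_rw [← hX1]
    simp_rw [← hX2] at hsq
    refine tendstoInDistribution_sum_of_martingaleDifference (𝒢 := 𝒢) (fun n k => ?_)
      (fun n k => (hint _).const_mul _) (fun n k => ?_) (fun δ hδ0 hδ => ?_) hsq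
    · exact (hmart.stronglyAdapted ((k + 1 : ℕ) : ℤ)).const_mul _
    · have h := hmart.condExp_eq_zero ((k + 1 : ℕ) : ℤ)
      have e : (((k + 1 : ℕ) : ℤ) - 1) = k := by push_cast; ring
      rw [e] at h
      refine (condExp_smul (c n (k + 1) / D n) (ξ ((k + 1 : ℕ) : ℤ)) (𝒢 k)).trans ?_
      filter_upwards [h] with ω hω
      change (c n (k + 1) / D n) • (μ[ξ ((k + 1 : ℕ) : ℤ) | ℱ k]) ω = 0
      rw [hω]
      simp
    · have h := hrow.tendsto_sum_integral_absTail hr hξ hint hident hDA hsum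
        (a := fun n k => c n k / D n) (fun n k => by rw [abs_div, abs_of_pos (hD0 n)]) hδ0 hδ
      refine h.congr fun n => ?_
      rw [← sum_range_add_one_eq_sum_Icc]
  · have hlim : Tendsto (fun n =>
        ∑ k ∈ Finset.Icc 1 (m n), r n k ^ 2 * truncMoment μ (ξ 0) (r n k)⁻¹) atTop (𝓝 1) := by
      have h := tendsto_sum_normTerm_normalizer hmono hH0 hAB hnd
      rw [← hD] at h
      refine h.congr' ?_
      filter_upwards [hHL] with n hn
      exact Finset.sum_congr rfl hn
    have hrM : ∀ᶠ n in atTop, ∀ k ∈ Finset.Icc 1 (m n),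
        r n k ^ 2 * truncMoment μ (ξ 0) (r n k)⁻¹ ≤
          ⨆ k : Finset.Icc 1 (m n), normTerm H c n (D n) k := by
      filter_upwards [hHL] with n hn k hk
      rw [← hn k hk]
      exact hle n k hk
    have h := hrow.tendstoInMeasure_sum_sq hr hξ hint hident hDA hmix hmax hrM hsum hlim
    have e : (fun n ω => 1 / D n ^ 2 * ∑ k ∈ Finset.Icc 1 (m n), c n k ^ 2 * ξ k ω ^ 2) =
        fun n ω => ∑ k ∈ Finset.Icc 1 (m n), r n k ^ 2 * ξ k ω ^ 2 := by
      funext n ω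
      rw [Finset.mul_sum]
      refine Finset.sum_congr rfl fun k _ => ?_
      simp only [hrdef]
      rw [div_pow, sq_abs]
      ring
    rw [e]
    exact h
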